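/- Let $\mathcal M=(S,A,\delta)$ be a finite Markov decision process: $S$ and $A$ are finite sets of states and actions, every state $t\in S$ has a non-empty set $A(t)\subseteq A$ of available actions, and for $t\in S$, $a\in A(t)$, $\delta(t,a)$ is a rational probability distribution on $S$. Let $\Omega\in\{\mathsf{mp},\mathsf{par}\}$, where for $\mathsf{mp}$ a weight function $w:A\to\mathbb Z$ and for $\mathsf{par}$ a priority function $p:S\to\mathbb N$ is given. Strategies $\sigma\in\Sigma$ map each history $s_0a_0\dots a_{n-1}s_n$ to a rational probability distribution on $A(s_n)$, and $\mathbb P^\sigma_{\mathcal M,s}$ is the induced probability measure on runs $\rho=s_0a_0s_1a_1\dots$ with $s_0=s$. Write $\rho[j]=s_j$ and $\rho[j,\infty]=s_ja_js_{j+1}\dots$. **Objectives.** For an integer $\lambda>0$, a run $\rho=s_0a_0s_1a_1\dots$ is in $\mathsf{GW}_{\mathsf{mp}}(\lambda)$ iff $\frac1{l+1}\sum_{i=0}^{l}w(a_i)\ge 0$ for some $0\le l<\lambda$, and in $\mathsf{GW}_{\mathsf{par}}(\lambda)$ iff there is $0\le l<\lambda$ such that $p(s_l)$ is even and $p(s_l)<p(s_k)$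 for all $k<l$. A run $\rho$ is in $\mathsf{DFW}_\Omega(\lambda)$ iff $\rho[j,\infty]\in\mathsf{GW}_\Omega(\lambda)$ for all $j\ge0$, and in $\mathsf{FW}_\Omega(\lambda)$ iff $\rho[i,\infty]\in\mathsf{DFW}_\Omega(\lambda)$ for some $i\ge0$. Finally $\mathsf{BW}_\Omega=\bigcup_{\lambda>0}\mathsf{FW}_\Omega(\lambda)$. **End-components.** A sub-MDP $\mathcal C=(S_{\mathcal C},A_{\mathcal C})$ of $\mathcal M$ consists of $S_{\mathcal C}\subseteq S$ and non-empty $A_{\mathcal C}(t)\subseteq A(t)$ for $t\in S_{\mathcal C}$ such that the support of $\delta(t,a)$ lies in $S_{\mathcal C}$ for all $t\in S_{\mathcal C}$, $a\in A_{\mathcal C}(t)$. It is an end-component (EC) if $S_{\mathcal C}\ne\emptyset$ and its underlying graph is strongly connected, and a maximal end-component (MEC) if moreover no other EC contains it (states and available actions, state by state). An EC $\mathcal C$ is $\lambda$-safe$_\Omega$ if there is a strategy in $\mathcal C$ all of whose consistent runs, from every state of $\mathcal C$, are in $\mathsf{DFW}_\Omega(\lambda)$. It is $\lambda$-good$_\Omega$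 if it contains a $\lambda$-safe$_\Omega$ EC, and $\mathsf{BW}$-good$_\Omega$ if it contains an EC that is $\lambda$-safe$_\Omega$ for some $\lambda>0$. **Algorithms.** $\mathsf{FixedWindow}(\mathcal M,s,\Omega,\lambda)$ starts with $T=\emptyset$, goes through all MECs $\mathcal C$ of $\mathcal M$, adds $S_{\mathcal C}$ to $T$ if $\mathcal C$ is $\lambda$-good$_\Omega$, and then returns the optimal (supremal) probability $\sup_{\sigma\in\Sigma}\mathbb P^\sigma_{\mathcal M,s}[\Diamond T]$ of reaching $T$ from $s$. $\mathsf{BoundedWindow}(\mathcal M,s,\Omega)$ is the same with "$\mathsf{BW}$-good$_\Omega$" in place of "$\lambda$-good$_\Omega$". **Lemma.** For every such $\mathcal M$ and $\Omega$, every $s\in S$ and every integer $\lambda>0$, $$\mathsf{FixedWindow}(\mathcal M,s,\Omega,\lambda)=\max_{\sigma\in\Sigma}\mathbb P^\sigma_{\mathcal M,s}[\mathsf{FW}_\Omega(\lambda)]=\max_{\sigma\in\Sigma}\mathbb P^\sigma_{\mathcal M,s}[\Diamond L],$$ $$\mathsf{BoundedWindow}(\mathcal M,s,\Omega)=\max_{\sigma\in\Sigma}\mathbb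 P^\sigma_{\mathcal M,s}[\mathsf{BW}_\Omega]=\max_{\sigma\in\Sigma}\mathbb P^\sigma_{\mathcal M,s}[\Diamond B],$$ where $L$ (resp. $B$) is the union of the state sets of the $\lambda$-good$_\Omega$ (resp. $\mathsf{BW}$-good$_\Omega$) MECs of $\mathcal M$, and $\Diamond X$ is the set of runs that visit $X$. In particular all four maxima are attained. -/

import Mathlib

open MeasureTheory ProbabilityTheory
open scoped ENNReal

namespace WindowMDP

/-- Rational probability distributions over a finite set `X`: functions `X → ℚ` that are
nonnegative and sum to `1`. -/
abbrev RatDist (X : Type*) [Fintype X] : Type _ := stdSimplex ℚ X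

/-- A rational distribution seen as a probability mass function. -/
noncomputable def RatDist.toPMF {X : Type*} [Fintype X] (d : RatDist X) : PMF X :=
  PMF.ofFintype (fun x => ENNReal.ofReal ((d x : ℚ) : ℝ)) (by
    have h : ∑ x, ((d x : ℚ) : ℝ) = 1 := by
      rw [← Rat.cast_sum, show ∑ x, d x = 1 from d.2.2, Rat.cast_one]
    have h0 : ∀ x ∈ Finset.univ, 0 ≤ ((d x : ℚ) : ℝ) := fun x _ => Rat.cast_nonneg.2 (d.2.1 x)
    rw [← ENNReal.ofReal_sum_of_nonneg h0, h, ENNReal.ofReal_one])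

/-- A finite Markov decision process `(states, act, δ)`.  The state set is a subset of a finite
type `S` (so that sub-MDPs of an MDP are again MDPs over the same type), the actions are taken from
the finite type `A`, and `act s` is the set of actions available in the state `s`.  The partial
transition function is a total function `δ` of which only the values at `(s, a)` with
`s ∈ states`, `a ∈ act s` are meaningful. -/
structure MDP (S A : Type*) [Fintype S] [Fintype A] where
  states : Set S
  act : S → Set A
  δ : S → A → RatDist S
  /-- Every state has an available action (no deadlocks); nothing is available elsewhere. -/
  act_nonempty_iff : ∀ s, (act s).Nonempty ↔ s ∈ states
  closed : ∀ s ∈ states, ∀ a ∈ act s, ∀ t, 0 < δ s a t → t ∈ states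

variable {S A : Type*} [Fintype S] [Fintype A]

/-- Infinite sequences `s₀ a₀ s₁ a₁ …`, the elements of `(SA)^ω`. -/
abbrev Seq (S A : Type*) : Type _ := ℕ → S × A

namespace Seq

/-- The `n`-th state. -/
def state (ρ : Seq S A) (n : ℕ) : S := (ρ n).1

/-- The `n`-th action. -/
def action (ρ : Seq S A) (n : ℕ) : A := (ρ n).2

/-- The suffix `ρ[n, ∞]`. -/
def suffix (ρ : Seq S A) (n : ℕ) : Seq S A := fun i => ρ (n + i)

/-- The list `s₀ a₀ … sₙ₋₁ aₙ₋₁`; followed by the state `sₙ` it is the prefix `ρ[0, n]`. -/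
def past (ρ : Seq S A) (n : ℕ) : List (S × A) := List.ofFn fun i : Fin n => ρ i

/-- The mean-payoff `(1 / n) ∑_{i < n} w(aᵢ)` of the prefix `ρ[0, n]` (used for `n > 0`). -/
def meanPayoff (w : A → ℤ) (ρ : Seq S A) (n : ℕ) : ℚ :=
  (∑ i ∈ Finset.range n, (w (ρ.action i) : ℚ)) / n

end Seq

/-- The two variants of window objectives: mean-payoff, with a weight function on actions, and
parity, with a priority function on states. -/
inductive Variant (S A : Type*) where
  | mp (w : A → ℤ)
  | par (p : S → ℕ)

namespace MDP

/-- The runs of `M`. -/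
def runs (M : MDP S A) : Set (Seq S A) :=
  {ρ | ρ.state 0 ∈ M.states ∧ ∀ i, ρ.action i ∈ M.act (ρ.state i) ∧
    0 < M.δ (ρ.state i) (ρ.action i) (ρ.state (i + 1))}

/-- Good window objective `GW_Ω(l)`. -/
def GW (M : MDP S A) : Variant S A → ℕ → Set (Seq S A)
  | .mp w, l => {ρ | ρ ∈ M.runs ∧ ∃ k < l, 0 ≤ ρ.meanPayoff w (k + 1)}
  | .par p, l => {ρ | ρ ∈ M.runs ∧ ∃ k < l, p (ρ.state k) % 2 = 0 ∧
      ∀ j < k, p (ρ.state k) < p (ρ.state j)}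

/-- Direct fixed window objective `DFW_Ω(l)`. -/
def DFW (M : MDP S A) (Ω : Variant S A) (l : ℕ) : Set (Seq S A) :=
  {ρ | ρ ∈ M.runs ∧ ∀ j, ρ.suffix j ∈ M.GW Ω l}

/-- Fixed window objective `FW_Ω(l)`. -/
def FW (M : MDP S A) (Ω : Variant S A) (l : ℕ) : Set (Seq S A) :=
  {ρ | ρ ∈ M.runs ∧ ∃ i, ρ.suffix i ∈ M.DFW Ω l}

/-- Bounded window objective `BW_Ω`. -/
def BW (M : MDP S A) (Ω : Variant S A) : Set (Seq S A) :=
  {ρ | ρ ∈ M.runs ∧ ∃ l > 0, ρ ∈ M.FW Ω l}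

/-- Reachability objective: the runs that visit `T`. -/
def reach (M : MDP S A) (T : Set S) : Set (Seq S A) :=
  {ρ | ρ ∈ M.runs ∧ ∃ i, ρ.state i ∈ T}

/-- Strategies of `M`, with randomization and unbounded memory: `next h s` is the distribution of
the next action after the history that consists of the list `h = [(s₀, a₀), …, (sₙ₋₁, aₙ₋₁)]` and
the last state `s = sₙ`.  Values at sequences that are not histories of `M` are never used. -/
structure Strategy (M : MDP S A) where
  next : List (S × A) → S → RatDist A
  next_supp : ∀ h, ∀ s ∈ M.states, ∀ a, 0 < next h s a → a ∈ M.act s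

namespace Strategy

variable {M : MDP S A}

/-- The runs from `s` that are consistent with `σ`: all their transitions have nonzero probability
in the Markov chain that `σ` induces from `s`. -/
def runsFrom (σ : M.Strategy) (s : S) : Set (Seq S A) :=
  {ρ | ρ.state 0 = s ∧ ∀ i, 0 < σ.next (ρ.past i) (ρ.state i) (ρ.action i) ∧
    0 < M.δ (ρ.state i) (ρ.action i) (ρ.state (i + 1))}

/-- Law of the pair (current state is `s`, next action) after the past `h`. -/
noncomputable def actPMF (σ : M.Strategy) (h : List (S × A)) (s : S) : PMF (S × A) :=
  (σ.next h s).toPMF.map fun a => (s, a)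

/-- Law of `(sₙ₊₁, aₙ₊₁)` given `s₀ a₀ … sₙ aₙ`: first `sₙ₊₁` is drawn from `δ(sₙ, aₙ)`, then
`aₙ₊₁` from the strategy at the history `s₀ a₀ … sₙ aₙ sₙ₊₁`. -/
noncomputable def stepPMF (σ : M.Strategy) (n : ℕ) (x : Finset.Iic n → S × A) : PMF (S × A) :=
  let z := x ⟨n, Finset.mem_Iic.2 le_rfl⟩
  (M.δ z.1 z.2).toPMF.bind fun t =>
    σ.actPMF (List.ofFn fun i : Fin (n + 1) =>
      x ⟨i, Finset.mem_Iic.2 (Nat.lt_succ_iff.1 i.2)⟩) t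

section Measure

variable [MeasurableSpace S] [DiscreteMeasurableSpace S]
  [MeasurableSpace A] [DiscreteMeasurableSpace A]

/-- The transition kernels of the process `(sₙ, aₙ)`. -/
noncomputable def kernel (σ : M.Strategy) (n : ℕ) : Kernel (Finset.Iic n → S × A) (S × A) :=
  Kernel.ofFunOfCountable fun x => (σ.stepPMF n x).toMeasure

instance (σ : M.Strategy) (n : ℕ) : IsMarkovKernel (σ.kernel n) :=
  ⟨fun x => inferInstanceAs (IsProbabilityMeasure (σ.stepPMF n x).toMeasure)⟩

/-- The probability measure `ℙ^σ_{M,s}` on `(SA)^ω`. -/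
noncomputable def prob (σ : M.Strategy) (s : S) : Measure (Seq S A) :=
  Kernel.trajMeasure (X := fun _ => S × A) (σ.actPMF [] s).toMeasure σ.kernel

end Measure

end Strategy

/-- A sub-MDP of `M`; its transition function is the restriction of that of `M`. -/
@[ext]
structure SubMDP (M : MDP S A) where
  states : Set S
  act : S → Set A
  states_subset : states ⊆ M.states
  act_subset : ∀ s ∈ states, act s ⊆ M.act s
  act_nonempty_iff : ∀ s, (act s).Nonempty ↔ s ∈ states
  closed : ∀ s ∈ states, ∀ a ∈ act s, ∀ t, 0 < M.δ s a t → t ∈ states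

namespace SubMDP

variable {M : MDP S A}

/-- A sub-MDP as an MDP. -/
def toMDP (C : M.SubMDP) : MDP S A where
  states := C.states
  act := C.act
  δ := M.δ
  act_nonempty_iff := C.act_nonempty_iff
  closed := C.closed

instance : LE M.SubMDP := ⟨fun C D => C.states ⊆ D.states ∧ ∀ s, C.act s ⊆ D.act s⟩

instance : Finite M.SubMDP :=
  Finite.of_injective (fun C : M.SubMDP => (C.states, C.act)) fun C D h => by
    rw [Prod.mk.injEq] at h
    exact SubMDP.ext h.1 h.2

/-- Edges of the underlying graph. -/
def Edge (C : M.SubMDP) (s t : S) : Prop := ∃ a ∈ C.act s, 0 < M.δ s a t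

/-- End-components: nonempty sub-MDPs whose underlying graph is strongly connected. -/
def IsEC (C : M.SubMDP) : Prop :=
  C.states.Nonempty ∧ ∀ s ∈ C.states, ∀ t ∈ C.states, Relation.ReflTransGen C.Edge s t

/-- Maximal end-components. -/
def IsMEC (C : M.SubMDP) : Prop := Maximal IsEC C

/-- `l`-safety: some strategy in `C` surely satisfies `DFW_Ω(l)` from every state of `C`. -/
def IsSafe (Ω : Variant S A) (l : ℕ) (C : M.SubMDP) : Prop :=
  ∃ σ : C.toMDP.Strategy, ∀ s ∈ C.states, σ.runsFrom s ⊆ C.toMDP.DFW Ω l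

/-- `l`-good: there is an `l`-safe sub-EC. -/
def IsGood (Ω : Variant S A) (l : ℕ) (C : M.SubMDP) : Prop :=
  ∃ D : M.SubMDP, D ≤ C ∧ D.IsEC ∧ D.IsSafe Ω l

/-- `BW`-good: there is a sub-EC that is `l`-safe for some `l > 0`. -/
def IsBWGood (Ω : Variant S A) (C : M.SubMDP) : Prop :=
  ∃ D : M.SubMDP, D ≤ C ∧ D.IsEC ∧ ∃ l > 0, D.IsSafe Ω l

end SubMDP

/-- The (finite) set of maximal end-components of `M`. -/
noncomputable def mecs (M : MDP S A) : Finset M.SubMDP :=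
  (Set.toFinite {C : M.SubMDP | C.IsMEC}).toFinset

section Algorithms

variable [MeasurableSpace S] [DiscreteMeasurableSpace S]
  [MeasurableSpace A] [DiscreteMeasurableSpace A]

/-- The value computed by the sub-procedure `MaxReachability`: the optimal probability of reaching
`T` from `s`. -/
noncomputable def maxReachability (M : MDP S A) (s : S) (T : Set S) : ℝ≥0∞ :=
  ⨆ σ : M.Strategy, σ.prob s (M.reach T)

/-- The loop common to both algorithms: start with `T = ∅`, go through all MECs, and add the states
of those that are classified as good. -/
noncomputable def collect (M : MDP S A) (good : M.SubMDP → Prop) : Set S :=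
  open Classical in
  M.mecs.toList.foldl (fun T C => if good C then T ∪ C.states else T) ∅

/-- Algorithm `FixedWindow(M, s, Ω, l)`. -/
noncomputable def fixedWindow (M : MDP S A) (s : S) (Ω : Variant S A) (l : ℕ) : ℝ≥0∞ :=
  M.maxReachability s (M.collect fun C => C.IsGood Ω l)

/-- Algorithm `BoundedWindow(M, s, Ω)`. -/
noncomputable def boundedWindow (M : MDP S A) (s : S) (Ω : Variant S A) : ℝ≥0∞ :=
  M.maxReachability s (M.collect fun C => C.IsBWGood Ω)

end Algorithms

end MDP

end WindowMDP

/-! Let `B` be the union of the selected safe end-components, `T ⊇ B` the union of the MECs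
containing one of them, and `V` the optimal value of reaching `B`. For either objective `W`, the
result is the sandwich `V s ≤ ℙ^σ[W] ≤ ℙ^σ[◇T] ≤ V s`, in which only the first inequality needs a
special `σ` (`isGreatest_of_safe`).

Last inequality: `V` is superharmonic and `1` on `B`, hence `1` on `T`, because the minimum of `V`
over an end-component spreads along its edges (`SubMDP.IsEC.eq_one`). Stopped on reaching `T`, it is
a supermartingale (`prob_reach_le`).

Middle inequality: a window of bound `m + 1` is decided by a block of `m + 1` state-action pairs. If
good blocks outside `T` could go on forever with positive probability, the blocks maximising that
probability would form a set in which one can stay surely (`exists_closed_of_stayValue`). A bottom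
component of this set projects to a safe end-component outside `T` (`exists_safe_of_closed`), which
is impossible. `BW` is a countable union of such cases.

First inequality: a memoryless policy that is optimal for discount factors arbitrarily close to `1`
attains `V` (`exists_value`, `le_prob_reach`). On reaching `B`, play switches to a safe strategy,
and the run wins (`exists_switch`). -/

set_option linter.unusedSectionVars false

namespace WindowMDP
variable {S A : Type*} [Fintype S] [Fintype A]

/-! ### The law of the state-action process and its one-step recursion. -/

section Law

lemma RatDist.toPMF_apply {X : Type*} [Fintype X] (d : RatDist X) (x : X) :
    d.toPMF x = ENNReal.ofReal ((d x : ℚ) : ℝ) := by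
  simp [RatDist.toPMF]

lemma RatDist.toPMF_ne_zero {X : Type*} [Fintype X] (d : RatDist X) (x : X) :
    d.toPMF x ≠ 0 ↔ 0 < d x := by
  rw [RatDist.toPMF_apply]; simp

lemma sum_pmf {X : Type*} [Fintype X] (p : PMF X) : ∑ x, p x = 1 := by
  rw [← p.tsum_coe, tsum_fintype]

/-- The sequence that follows `x` and then stays constant. -/
def extendConst {E : Type*} {n : ℕ} (x : Finset.Iic n → E) (i : ℕ) : E :=
  if h : i ≤ n then x ⟨i, Finset.mem_Iic.2 h⟩ else x ⟨n, Finset.mem_Iic.2 le_rfl⟩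

lemma extendConst_frestrictLe {E : Type*} {n : ℕ} (ρ : ℕ → E) {i : ℕ} (hi : i ≤ n) :
    extendConst (Preorder.frestrictLe (π := fun _ => E) n ρ) i = ρ i := by
  simp [extendConst, hi]

lemma dependsOn_eq_comp {E F : Type*} {n : ℕ} {f : (ℕ → E) → F} (hf : DependsOn f (Set.Iic n)) :
    f = (fun x => f (extendConst x)) ∘ Preorder.frestrictLe (π := fun _ => E) n := by
  funext ρ
  exact hf fun i hi => (extendConst_frestrictLe ρ hi).symm

/-- Such a function factors through a finite product, where every function is measurable. -/
lemma measurable_of_dependsOn {E F : Type*} [Finite E] [MeasurableSpace E]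
    [DiscreteMeasurableSpace E] [MeasurableSpace F] {n : ℕ} {f : (ℕ → E) → F}
    (hf : DependsOn f (Set.Iic n)) : Measurable f := by
  rw [dependsOn_eq_comp hf]
  exact (measurable_of_finite _).comp (Preorder.measurable_frestrictLe n)

namespace Seq

lemma past_succ (ρ : Seq S A) (n : ℕ) : ρ.past (n + 1) = ρ.past n ++ [ρ n] := by
  rw [past, past, List.ofFn_succ_last]
  simp

lemma past_zero (ρ : Seq S A) : ρ.past 0 = [] := by simp [past]

lemma past_congr {ρ ρ' : Seq S A} {n : ℕ} (h : ∀ i < n, ρ i = ρ' i) : ρ.past n = ρ'.past n := by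
  unfold past
  congr 1
  funext i
  exact h i i.2

end Seq

namespace MDP.Strategy

variable {M : MDP S A}

/-- Expected value of `f` at the next state-action pair, after the history `h` with last pair `z`. -/
noncomputable def stepExp (σ : M.Strategy) (h : List (S × A)) (z : S × A) (f : S × A → ℝ≥0∞) :
    ℝ≥0∞ :=
  ∑ t, (M.δ z.1 z.2).toPMF t * ∑ b, (σ.next h t).toPMF b * f (t, b)

variable [MeasurableSpace S] [DiscreteMeasurableSpace S]
  [MeasurableSpace A] [DiscreteMeasurableSpace A]

omit [MeasurableSpace S] [DiscreteMeasurableSpace S] [MeasurableSpace A]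
  [DiscreteMeasurableSpace A] in
lemma sum_actPMF (σ : M.Strategy) (h : List (S × A)) (s : S) (f : S × A → ℝ≥0∞) :
    ∑ z, f z * σ.actPMF h s z = ∑ b, (σ.next h s).toPMF b * f (s, b) := by
  classical
  simp only [actPMF, PMF.map_apply, tsum_fintype, Finset.mul_sum, mul_ite, mul_zero]
  rw [Finset.sum_comm]
  refine Finset.sum_congr rfl fun b _ => ?_
  simp [mul_comm]

instance (σ : M.Strategy) (s : S) : IsProbabilityMeasure (σ.prob s) := by
  unfold prob; infer_instance

lemma lintegral_stepPMF (σ : M.Strategy) (n : ℕ) (ρ : Seq S A) (f : S × A → ℝ≥0∞) :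
    ∫⁻ z, f z ∂(σ.stepPMF n (Preorder.frestrictLe n ρ)).toMeasure =
      σ.stepExp (ρ.past (n + 1)) (ρ n) f := by
  rw [lintegral_fintype]
  simp only [PMF.toMeasure_apply_singleton _ _ (measurableSet_singleton _), stepPMF,
    PMF.bind_apply, tsum_fintype, Finset.mul_sum, stepExp]
  rw [Finset.sum_comm]
  refine Finset.sum_congr rfl fun t _ => ?_
  rw [← Finset.mul_sum, ← sum_actPMF, Finset.mul_sum]
  refine Finset.sum_congr rfl fun z _ => ?_
  rw [← mul_assoc, mul_comm (f z), mul_assoc]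
  rfl

/-- The joint law of a prefix and the next pair is the law of the prefix composed with the kernel.
All later (super)martingale arguments use the measure through this identity and `lintegral_first`.
-/
lemma lintegral_succ (σ : M.Strategy) (s : S) (n : ℕ) (H : Seq S A → S × A → ℝ≥0∞)
    (hH : DependsOn H (Set.Iic n)) :
    ∫⁻ ρ, H ρ (ρ (n + 1)) ∂σ.prob s =
      ∫⁻ ρ, σ.stepExp (ρ.past (n + 1)) (ρ n) (H ρ) ∂σ.prob s := by
  have key := Kernel.map_frestrictLe_trajMeasure_compProd_eq_map_trajMeasure
    (X := fun _ => S × A) (μ₀ := (σ.actPMF [] s).toMeasure) (κ := σ.kernel) (a := n)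
  have h1 : ∫⁻ ρ, H ρ (ρ (n + 1)) ∂σ.prob s =
      ∫⁻ p : (Finset.Iic n → S × A) × (S × A), H (extendConst p.1) p.2
        ∂((σ.prob s).map (fun x => (Preorder.frestrictLe n x, x (n + 1)))) := by
    rw [lintegral_map (measurable_of_finite _)
      ((Preorder.measurable_frestrictLe n).prodMk (measurable_pi_apply _))]
    refine lintegral_congr fun ρ => ?_
    exact congrFun (congrFun (dependsOn_eq_comp hH) ρ) _
  rw [h1]
  unfold prob
  rw [← key, Measure.lintegral_compProd (measurable_of_finite _),
    lintegral_map (measurable_of_finite _) (Preorder.measurable_frestrictLe n)]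
  refine lintegral_congr fun ρ => ?_
  rw [← lintegral_stepPMF]
  have := congrFun (dependsOn_eq_comp hH) ρ
  simp only [Function.comp_apply] at this
  simp only
  rw [← this]
  rfl

lemma lintegral_first (σ : M.Strategy) (s : S) (f : S × A → ℝ≥0∞) :
    ∫⁻ ρ, f (ρ 0) ∂σ.prob s = ∑ b, (σ.next [] s).toPMF b * f (s, b) := by
  rw [← sum_actPMF]
  have h1 : ∫⁻ ρ, f (ρ 0) ∂σ.prob s = ∫⁻ x : Finset.Iic 0 → S × A, f (extendConst x 0)
      ∂((σ.prob s).map (Preorder.frestrictLe 0)) := by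
    rw [lintegral_map (measurable_of_finite _) (Preorder.measurable_frestrictLe 0)]
    exact lintegral_congr fun ρ => by rw [extendConst_frestrictLe _ le_rfl]
  have h2 : (σ.prob s).map (Preorder.frestrictLe 0) =
      (σ.actPMF [] s).toMeasure.map
        (MeasurableEquiv.piUnique (fun _ : Finset.Iic 0 => S × A)).symm := by
    unfold prob Kernel.trajMeasure
    rw [Measure.map_comp _ _ (Preorder.measurable_frestrictLe 0), Kernel.traj_map_frestrictLe,
      Kernel.partialTraj_self, Measure.id_comp]
  rw [h1, h2, lintegral_map (measurable_of_finite _) (MeasurableEquiv.measurable _),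
    lintegral_fintype]
  refine Finset.sum_congr rfl fun z _ => ?_
  rw [PMF.toMeasure_apply_singleton _ _ (measurableSet_singleton _)]
  rfl

lemma ae_zero (σ : M.Strategy) (s : S) :
    ∀ᵐ ρ ∂σ.prob s, (ρ 0).1 = s ∧ 0 < σ.next [] (ρ 0).1 (ρ 0).2 := by
  classical
  have h := lintegral_first σ s
    (fun z => if z.1 = s ∧ 0 < σ.next [] z.1 z.2 then 0 else 1)
  rw [Finset.sum_eq_zero] at h
  · have hm : Measurable fun ρ : Seq S A =>
        (if (ρ 0).1 = s ∧ 0 < σ.next [] (ρ 0).1 (ρ 0).2 then 0 else 1 : ℝ≥0∞) :=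
      measurable_of_dependsOn (n := 0) fun ρ ρ' h => by rw [h 0 (Set.mem_Iic.2 le_rfl)]
    rw [lintegral_eq_zero_iff hm] at h
    filter_upwards [h] with ρ hρ
    by_contra hc
    simp [hc] at hρ
  · intro b _
    by_cases hb : 0 < σ.next [] s b
    · simp [hb]
    · rw [← RatDist.toPMF_ne_zero, not_not] at hb
      simp [hb]

lemma ae_succ (σ : M.Strategy) (s : S) (n : ℕ) :
    ∀ᵐ ρ ∂σ.prob s, 0 < M.δ (ρ n).1 (ρ n).2 (ρ (n + 1)).1 ∧
      0 < σ.next (ρ.past (n + 1)) (ρ (n + 1)).1 (ρ (n + 1)).2 := by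
  classical
  -- The indicator of an inconsistent step; its conditional expectation vanishes term by term.
  let H : Seq S A → S × A → ℝ≥0∞ := fun ρ z =>
    if 0 < M.δ (ρ n).1 (ρ n).2 z.1 ∧ 0 < σ.next (ρ.past (n + 1)) z.1 z.2 then 0 else 1
  have hH : DependsOn H (Set.Iic n) := by
    intro ρ ρ' h
    funext z
    have hp : Seq.past ρ (n + 1) = Seq.past ρ' (n + 1) :=
      Seq.past_congr fun i hi => h i (Nat.lt_succ_iff.1 hi)
    simp only [H, h n (Set.mem_Iic.2 le_rfl), hp]
  have h := lintegral_succ σ s n H hH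
  have h0 : ∀ ρ : Seq S A, σ.stepExp (ρ.past (n + 1)) (ρ n) (H ρ) = 0 := by
    intro ρ
    refine Finset.sum_eq_zero fun t _ => ?_
    by_cases ht : 0 < M.δ (ρ n).1 (ρ n).2 t
    · rw [Finset.sum_eq_zero, mul_zero]
      intro b _
      by_cases hb : 0 < σ.next (ρ.past (n + 1)) t b
      · simp [H, ht, hb]
      · rw [← RatDist.toPMF_ne_zero, not_not] at hb
        simp [hb]
    · rw [← RatDist.toPMF_ne_zero, not_not] at ht
      simp [ht]
  simp only [h0, MeasureTheory.lintegral_zero] at h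
  have hm : Measurable fun ρ : Seq S A => H ρ (ρ (n + 1)) := by
    refine measurable_of_dependsOn (n := n + 1) fun ρ ρ' hρ => ?_
    rw [hH fun i hi => hρ i (Nat.le_succ_of_le hi), hρ (n + 1) (Set.mem_Iic.2 le_rfl)]
  rw [lintegral_eq_zero_iff hm] at h
  filter_upwards [h] with ρ hρ
  by_contra hc
  simp [H, hc] at hρ

/-- Almost all sequences are consistent runs. -/
lemma ae_mem_runsFrom (σ : M.Strategy) (s : S) : ∀ᵐ ρ ∂σ.prob s, ρ ∈ σ.runsFrom s := by
  filter_upwards [ae_zero σ s, ae_all_iff.2 (ae_succ σ s)] with ρ h0 h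
  refine ⟨h0.1, fun i => ⟨?_, (h i).1⟩⟩
  cases i with
  | zero => rw [Seq.past_zero]; exact h0.2
  | succ n => exact (h n).2

omit [MeasurableSpace S] [DiscreteMeasurableSpace S] [MeasurableSpace A]
  [DiscreteMeasurableSpace A] in
lemma runsFrom_subset_runs (σ : M.Strategy) {s : S} (hs : s ∈ M.states) :
    σ.runsFrom s ⊆ M.runs := by
  rintro ρ ⟨h0, h⟩
  have hst : ∀ i, ρ.state i ∈ M.states := by
    intro i
    induction i with
    | zero => rw [h0]; exact hs
    | succ n ih => exact M.closed _ ih _ (σ.next_supp _ _ ih _ (h n).1) _ (h n).2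
  exact ⟨hst 0, fun i => ⟨σ.next_supp _ _ (hst i) _ (h i).1, (h i).2⟩⟩

end MDP.Strategy

namespace MDP

variable {M : MDP S A}

lemma state_mem_of_mem_runs {ρ : Seq S A} (h : ρ ∈ M.runs) (i : ℕ) : ρ.state i ∈ M.states := by
  rw [← M.act_nonempty_iff]
  exact ⟨_, (h.2 i).1⟩

lemma suffix_mem_runs {ρ : Seq S A} (h : ρ ∈ M.runs) (i : ℕ) : ρ.suffix i ∈ M.runs :=
  ⟨state_mem_of_mem_runs h i, fun j => h.2 (i + j)⟩

end MDP

end Law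

/-! ### Optimal reachability values via discounting. -/

section Values

/-- Strict inequality at one support point would make the averages strictly ordered, as the
remaining terms of the smaller one are finite. This spreads extremal values to successors. -/
lemma eq_of_sum_pmf_le {X : Type*} [Fintype X] (p : PMF X) {f g : X → ℝ≥0∞}
    (hfg : ∀ x, p x ≠ 0 → f x ≤ g x) (hg : ∀ x, p x ≠ 0 → f x ≠ ⊤)
    (h : ∑ x, p x * g x ≤ ∑ x, p x * f x) {x : X} (hx : p x ≠ 0) : f x = g x := by
  classical
  by_contra hne
  have hlt : f x < g x := lt_of_le_of_ne (hfg x hx) hne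
  refine absurd h (not_le.2 ?_)
  rw [← Finset.add_sum_erase _ _ (Finset.mem_univ x), ← Finset.add_sum_erase Finset.univ
    (fun x => p x * g x) (Finset.mem_univ x)]
  refine ENNReal.add_lt_add_of_lt_of_le ?_ ?_ ?_
  · refine (ENNReal.sum_lt_top.2 fun y _ => ?_).ne
    by_cases hy : p y = 0
    · simp [hy]
    · exact ENNReal.mul_lt_top (p.apply_lt_top y) (hg y hy).lt_top
  · exact (ENNReal.mul_lt_mul_iff_right hx (p.apply_ne_top x)).2 hlt
  · refine Finset.sum_le_sum fun y _ => ?_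
    by_cases hy : p y = 0
    · simp [hy]
    · exact mul_le_mul_right (hfg y hy) _

lemma sum_pmf_mul_const {X : Type*} [Fintype X] (p : PMF X) (c : ℝ≥0∞) : ∑ x, p x * c = c := by
  rw [← Finset.sum_mul, sum_pmf, one_mul]

lemma sum_pmf_mul_le {X : Type*} [Fintype X] (p : PMF X) {f : X → ℝ≥0∞} {c : ℝ≥0∞}
    (h : ∀ x, p x ≠ 0 → f x ≤ c) : ∑ x, p x * f x ≤ c := by
  rw [← sum_pmf_mul_const p c]
  refine Finset.sum_le_sum fun y _ => ?_
  by_cases hy : p y = 0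
  · simp [hy]
  · exact mul_le_mul_right (h y hy) _

namespace MDP

variable (M : MDP S A)

/-- The Bellman operator of the reachability objective for `B` with discount factor `β`. -/
noncomputable def bellman (B : Set S) (β : ℝ≥0∞) : (S → ℝ≥0∞) →o (S → ℝ≥0∞) where
  toFun f t := open Classical in
    if t ∈ B then 1 else β * ⨆ a ∈ M.act t, ∑ u, (M.δ t a).toPMF u * f u
  monotone' f g hfg t := by
    dsimp only
    split_ifs
    · exact le_rfl
    · exact mul_le_mul_right (iSup₂_mono fun a _ =>
        Finset.sum_le_sum fun u _ => mul_le_mul_right (hfg u) _) _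

open Classical in
lemma bellman_apply (B : Set S) (β : ℝ≥0∞) (f : S → ℝ≥0∞) (t : S) : M.bellman B β f t =
    if t ∈ B then 1 else β * ⨆ a ∈ M.act t, ∑ u, (M.δ t a).toPMF u * f u := rfl

/-- The optimal discounted reachability value. -/
noncomputable def discountedValue (B : Set S) (β : ℝ≥0∞) : S → ℝ≥0∞ := (M.bellman B β).lfp

lemma discountedValue_of_mem {B : Set S} (β : ℝ≥0∞) {t : S} (ht : t ∈ B) :
    M.discountedValue B β t = 1 := by
  rw [discountedValue, ← (M.bellman B β).map_lfp]
  rw [bellman_apply, if_pos ht]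

lemma discountedValue_of_notMem {B : Set S} (β : ℝ≥0∞) {t : S} (ht : t ∉ B) :
    M.discountedValue B β t =
      β * ⨆ a ∈ M.act t, ∑ u, (M.δ t a).toPMF u * M.discountedValue B β u := by
  conv_lhs => rw [discountedValue, ← (M.bellman B β).map_lfp, bellman_apply, if_neg ht]
  rfl

lemma discountedValue_le_one {B : Set S} {β : ℝ≥0∞} (hβ : β ≤ 1) (t : S) :
    M.discountedValue B β t ≤ 1 := by
  refine (M.bellman B β).lfp_le (a := fun _ => 1) (fun t => ?_) t
  rw [bellman_apply]
  split_ifs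
  · exact le_rfl
  · exact mul_le_one' hβ (iSup₂_le fun a _ => sum_pmf_mul_le _ fun _ _ => le_rfl)

lemma discountedValue_mono (B : Set S) : Monotone (M.discountedValue B) := by
  intro β β' h
  refine OrderHom.lfp.monotone fun f t => ?_
  rw [bellman_apply, bellman_apply]
  split_ifs
  · exact le_rfl
  · exact mul_le_mul_left h _

/-- Discounting matters here: with `β = 1`, actions attaining the maximum may circle forever without
reaching `B`, whereas for `β < 1` the greedy policy does achieve the value. -/
lemma exists_greedy {s₀ : S} (hs₀ : s₀ ∈ M.states) (B : Set S) (β : ℝ≥0∞) :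
    ∃ a : S → A, ∀ t ∈ M.states, a t ∈ M.act t ∧
    (t ∉ B → M.discountedValue B β t =
      β * ∑ u, (M.δ t (a t)).toPMF u * M.discountedValue B β u) := by
  classical
  have h : ∀ t, ∃ a, t ∈ M.states → a ∈ M.act t ∧ (t ∉ B → M.discountedValue B β t =
      β * ∑ u, (M.δ t a).toPMF u * M.discountedValue B β u) := by
    intro t
    by_cases ht : t ∈ M.states
    · obtain ⟨a, ha, hmax⟩ := Set.exists_max_image (M.act t)
        (fun a => ∑ u, (M.δ t a).toPMF u * M.discountedValue B β u) (Set.toFinite _)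
        ((M.act_nonempty_iff t).2 ht)
      refine ⟨a, fun _ => ⟨ha, fun htB => ?_⟩⟩
      rw [M.discountedValue_of_notMem β htB]
      congr 1
      exact le_antisymm (iSup₂_le hmax) (le_iSup₂_of_le a ha le_rfl)
    -- Outside `M.states` any action will do; `s₀` only witnesses that `A` is inhabited.
    · exact ⟨((M.act_nonempty_iff s₀).2 hs₀).some, fun h => absurd h ht⟩
  choose a ha using h
  exact ⟨a, fun t ht => ha t ht⟩

/-- The optimal value `V` of reaching `B`, together with an optimal memoryless policy `a`: `V` is
superharmonic, and it is approximated by the discounted values that `a` achieves. -/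
lemma exists_value {s₀ : S} (hs₀ : s₀ ∈ M.states) (B : Set S) :
    ∃ (V : S → ℝ≥0∞) (a : S → A), (∀ t ∈ M.states, a t ∈ M.act t) ∧ (∀ t, V t ≤ 1) ∧
      (∀ t ∈ B, V t = 1) ∧
      (∀ t, ∀ b ∈ M.act t, ∑ u, (M.δ t b).toPMF u * V u ≤ V t) ∧
      ∀ (s : S) (c : ℝ≥0∞), (∀ β < 1, ∀ f : S → ℝ≥0∞, (∀ t, f t ≤ 1) →
        (∀ t ∈ M.states, t ∉ B → f t = β * ∑ u, (M.δ t (a t)).toPMF u * f u) → f s ≤ c) →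
          V s ≤ c := by
  obtain ⟨β, hβ, hβlt, hβlim⟩ := exists_seq_strictMono_tendsto' (zero_lt_one : (0 : ℝ≥0∞) < 1)
  choose a ha using fun n => M.exists_greedy hs₀ B (β n)
  -- Pigeonhole: there are finitely many policies, so one is greedy for infinitely many `β n`.
  obtain ⟨a₀, ha₀⟩ := Finite.exists_infinite_fiber a
  rw [Set.infinite_coe_iff] at ha₀
  have hmono : ∀ t, Monotone fun n => M.discountedValue B (β n) t := fun t m n hmn =>
    M.discountedValue_mono B (hβ.monotone hmn) t
  refine ⟨fun t => ⨆ n, M.discountedValue B (β n) t, a₀, ?_, ?_, ?_, ?_, ?_⟩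
  · obtain ⟨n, hn⟩ := ha₀.nonempty
    intro t ht
    rw [← show a n = a₀ from hn]
    exact (ha n t ht).1
  · exact fun t => iSup_le fun n => M.discountedValue_le_one (hβlt n).2.le t
  · intro t ht
    simp [M.discountedValue_of_mem _ ht]
  · intro t b hb
    by_cases ht : t ∈ B
    · simp only [M.discountedValue_of_mem _ ht, ciSup_const]
      exact sum_pmf_mul_le _ fun u _ => iSup_le fun n => M.discountedValue_le_one (hβlt n).2.le u
    · simp only [ENNReal.mul_iSup]
      rw [ENNReal.finsetSum_iSup_of_monotone
        (f := fun u n => (M.δ t b).toPMF u * M.discountedValue B (β n) u)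
        fun u m n hmn => mul_le_mul_right (hmono u hmn) _]
      -- The missing factor `β` is restored as a second supremum; the index `max m n` dominates
      -- both.
      have h1 : ⨆ m, β m = 1 := iSup_eq_of_tendsto hβ.monotone hβlim
      refine iSup_le fun n => ?_
      rw [← one_mul (∑ u, _), ← h1, ENNReal.iSup_mul]
      refine iSup_le fun m => ?_
      refine le_iSup_of_le (max m n) ?_
      rw [M.discountedValue_of_notMem _ ht]
      refine mul_le_mul' (hβ.monotone (le_max_left m n)) (le_iSup₂_of_le b hb ?_)
      exact Finset.sum_le_sum fun u _ => mul_le_mul_right (hmono u (le_max_right m n)) _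
  · intro s c h
    refine iSup_le fun n => ?_
    obtain ⟨m, hm, hnm⟩ := ha₀.exists_gt n
    refine (hmono s hnm.le).trans (h (β m) (hβlt m).2 _
      (M.discountedValue_le_one (hβlt m).2.le) fun t ht htB => ?_)
    rw [← show a m = a₀ from hm]
    exact (ha m t ht).2 htB

/-- A superharmonic function that is `1` somewhere on an end-component and at most `1` overall
is `1` everywhere on it. -/
lemma SubMDP.IsEC.eq_one {M : MDP S A} {C : M.SubMDP} (hC : C.IsEC) {V : S → ℝ≥0∞}
    (hV : ∀ t, V t ≤ 1) (hsup : ∀ t, ∀ b ∈ M.act t, ∑ u, (M.δ t b).toPMF u * V u ≤ V t)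
    {t₁ : S} (ht₁ : t₁ ∈ C.states) (h1 : V t₁ = 1) {t : S} (ht : t ∈ C.states) : V t = 1 := by
  -- At a minimiser, the average over successors is at most the minimum, so every successor is a
  -- minimiser too; strong connectivity then reaches `t₁`.
  obtain ⟨m, hm, hmin⟩ := Set.exists_min_image C.states V (Set.toFinite _) hC.1
  have hstep : ∀ u, Relation.ReflTransGen C.Edge m u → u ∈ C.states ∧ V u = V m := by
    intro u hu
    induction hu with
    | refl => exact ⟨hm, rfl⟩
    | @tail u v _ huv ih =>
      obtain ⟨b, hb, hpos⟩ := huv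
      refine ⟨C.closed u ih.1 b hb v hpos, ?_⟩
      refine (eq_of_sum_pmf_le (M.δ u b).toPMF (f := fun _ => V m) (g := V)
        (fun x hx => hmin x (C.closed u ih.1 b hb x ((RatDist.toPMF_ne_zero _ _).1 hx)))
        (fun _ _ => ne_top_of_le_ne_top ENNReal.one_ne_top (hV m)) ?_
        ((RatDist.toPMF_ne_zero _ _).2 hpos)).symm
      rw [sum_pmf_mul_const, ← ih.2]
      exact hsup u b (C.act_subset u ih.1 hb)
  have hm1 : V m = 1 := by rw [← h1, (hstep t₁ (hC.2 m hm t₁ ht₁)).2]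
  exact le_antisymm (hV t) (hm1 ▸ hmin t ht)

end MDP
end Values

/-! ### Bounds on reachability probabilities. -/

section Reachability

/-- The sequence visits `B` within its first `n + 1` states. -/
def Seq.Visits (B : Set S) (n : ℕ) (ρ : Seq S A) : Prop := ∃ i ≤ n, ρ.state i ∈ B

lemma Seq.dependsOn_visits (B : Set S) (n : ℕ) :
    DependsOn (Seq.Visits (A := A) B n) (Set.Iic n) := by
  intro ρ ρ' h
  refine propext (exists_congr fun i => and_congr_right fun hi => ?_)
  rw [state, state, h i (Set.mem_Iic.2 hi)]

lemma Seq.visits_succ {B : Set S} {n : ℕ} {ρ : Seq S A} :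
    ρ.Visits B (n + 1) ↔ ρ.Visits B n ∨ (ρ (n + 1)).1 ∈ B := by
  constructor
  · rintro ⟨i, hi, h⟩
    rcases Nat.le_succ_iff.1 hi with hi | rfl
    · exact Or.inl ⟨i, hi, h⟩
    · exact Or.inr h
  · rintro (⟨i, hi, h⟩ | h)
    · exact ⟨i, Nat.le_succ_of_le hi, h⟩
    · exact ⟨n + 1, le_rfl, h⟩

namespace MDP.Strategy

variable {M : MDP S A}

lemma stepExp_le (σ : M.Strategy) (h : List (S × A)) (z : S × A) {f : S × A → ℝ≥0∞}
    {g : S → ℝ≥0∞} (hfg : ∀ t b, f (t, b) ≤ g t) :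
    σ.stepExp h z f ≤ ∑ t, (M.δ z.1 z.2).toPMF t * g t :=
  Finset.sum_le_sum fun t _ => mul_le_mul_right (sum_pmf_mul_le _ fun b _ => hfg t b) _

lemma le_stepExp (σ : M.Strategy) (h : List (S × A)) (z : S × A) {f : S × A → ℝ≥0∞}
    {g : S → ℝ≥0∞} (hfg : ∀ t b, g t ≤ f (t, b)) :
    ∑ t, (M.δ z.1 z.2).toPMF t * g t ≤ σ.stepExp h z f := by
  refine Finset.sum_le_sum fun t _ => mul_le_mul_right ?_ _
  rw [← sum_pmf_mul_const (σ.next h t).toPMF (g t)]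
  exact Finset.sum_le_sum fun b _ => mul_le_mul_right (hfg t b) _

variable [MeasurableSpace S] [DiscreteMeasurableSpace S]
  [MeasurableSpace A] [DiscreteMeasurableSpace A]

/-- A superharmonic function that is `1` on `B` bounds the probability of reaching `B`. -/
lemma prob_reach_le (σ : M.Strategy) {s : S} (hs : s ∈ M.states) {B : Set S} {V : S → ℝ≥0∞}
    (hB : ∀ t ∈ B, V t = 1)
    (hsup : ∀ t, ∀ b ∈ M.act t, ∑ u, (M.δ t b).toPMF u * V u ≤ V t) :
    σ.prob s (M.reach B) ≤ V s := by
  classical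
  -- `V` along the run, frozen at `1` from the first visit to `B`: a supermartingale, to which
  -- Markov's inequality applies.
  let f : ℕ → Seq S A → ℝ≥0∞ := fun n ρ => if ρ.Visits B n then 1 else V (ρ n).1
  have hf : ∀ n, DependsOn (f n) (Set.Iic n) := fun n ρ ρ' h => by
    simp only [f, Seq.dependsOn_visits B n h, h n (Set.mem_Iic.2 le_rfl)]
  have h0 : ∫⁻ ρ, f 0 ρ ∂σ.prob s ≤ V s := by
    have : ∀ ρ : Seq S A, f 0 ρ = V (ρ 0).1 := by
      intro ρ
      simp only [f]
      split_ifs with h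
      · obtain ⟨i, hi, h⟩ := h
        rw [Nat.le_zero.1 hi] at h
        exact (hB _ h).symm
      · rfl
    simp only [this]
    rw [lintegral_first σ s fun z => V z.1]
    exact sum_pmf_mul_le _ fun _ _ => le_rfl
  have hsucc : ∀ n, ∫⁻ ρ, f (n + 1) ρ ∂σ.prob s ≤ ∫⁻ ρ, f n ρ ∂σ.prob s := by
    intro n
    let H : Seq S A → S × A → ℝ≥0∞ := fun ρ z => if ρ.Visits B n then 1 else V z.1
    have hH : DependsOn H (Set.Iic n) := fun ρ ρ' h => by
      simp only [H, Seq.dependsOn_visits B n h]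
    have : ∀ ρ : Seq S A, f (n + 1) ρ = H ρ (ρ (n + 1)) := by
      intro ρ
      simp only [f, H, Seq.visits_succ]
      by_cases h1 : ρ.Visits B n
      · simp [h1]
      · by_cases h2 : (ρ (n + 1)).1 ∈ B
        · simp [h1, h2, hB _ h2]
        · simp [h1, h2]
    simp only [this]
    rw [lintegral_succ σ s n H hH]
    refine lintegral_mono_ae ?_
    filter_upwards [ae_mem_runsFrom σ s] with ρ hρ
    have hρ' := runsFrom_subset_runs σ hs hρ
    by_cases h1 : ρ.Visits B n
    · simp only [f, if_pos h1]
      exact (σ.stepExp_le _ _ (g := fun _ => 1) fun t b => by simp [H, h1]).trans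
        (sum_pmf_mul_le _ fun _ _ => le_rfl)
    · simp only [f, if_neg h1]
      exact (σ.stepExp_le _ _ (g := V) fun t b => by simp [H, h1]).trans
        (hsup _ _ (hρ'.2 n).1)
  have hle : ∀ n, σ.prob s {ρ | ρ.Visits B n} ≤ V s := by
    intro n
    have h1 : ∫⁻ ρ, f n ρ ∂σ.prob s ≤ V s := by
      induction n with
      | zero => exact h0
      | succ n ih => exact (hsucc n).trans ih
    refine le_trans ?_ h1
    have := mul_meas_ge_le_lintegral (μ := σ.prob s) (measurable_of_dependsOn (hf n)) 1
    rw [one_mul] at this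
    refine le_trans (measure_mono fun ρ hρ => ?_) this
    simp only [Set.mem_ofPred_eq] at hρ ⊢
    simp [f, hρ]
  have hsub : M.reach B ⊆ ⋃ n, {ρ | ρ.Visits B n} := by
    rintro ρ ⟨-, i, hi⟩
    exact Set.mem_iUnion.2 ⟨i, i, le_rfl, hi⟩
  refine (measure_mono hsub).trans ?_
  have hmono : Monotone fun n => {ρ : Seq S A | ρ.Visits B n} := by
    rintro m n hmn ρ ⟨i, hi, h⟩
    exact ⟨i, hi.trans hmn, h⟩
  rw [hmono.measure_iUnion]
  exact iSup_le hle

/-- A strategy that follows the memoryless policy `a` until it visits `B`. -/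
def Follows (σ : M.Strategy) (a : S → A) (B : Set S) : Prop :=
  ∀ h t, (∀ z ∈ h, z.1 ∉ B) → t ∉ B → t ∈ M.states → ∀ b, 0 < σ.next h t b → b = a t

/-- The process `β ^ n * f (sₙ)`, frozen at `1` on visiting `B`, is a submartingale. Runs that have
not yet visited `B` contribute at most `β ^ n`, which tends to `0`; no uniqueness of `f` is needed.
-/
lemma le_prob_reach (σ : M.Strategy) {s : S} (hs : s ∈ M.states) {B : Set S} {a : S → A}
    (hσ : σ.Follows a B) {β : ℝ≥0∞} (hβ : β < 1) {f : S → ℝ≥0∞} (hf1 : ∀ t, f t ≤ 1)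
    (hf : ∀ t ∈ M.states, t ∉ B → f t = β * ∑ u, (M.δ t (a t)).toPMF u * f u) :
    f s ≤ σ.prob s (M.reach B) := by
  classical
  let g : ℕ → Seq S A → ℝ≥0∞ := fun n ρ => if ρ.Visits B n then 1 else β ^ n * f (ρ n).1
  have hg1 : ∀ n (x : S), β ^ n * f x ≤ 1 := fun n x =>
    mul_le_one' (pow_le_one₀ zero_le hβ.le) (hf1 _)
  have h0 : f s ≤ ∫⁻ ρ, g 0 ρ ∂σ.prob s := by
    have : ∀ ρ : Seq S A, f (ρ 0).1 ≤ g 0 ρ := by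
      intro ρ
      simp only [g]
      split_ifs
      · exact hf1 _
      · simp
    refine le_trans ?_ (lintegral_mono this)
    rw [lintegral_first σ s fun z => f z.1]
    exact (sum_pmf_mul_const _ _).ge
  have hsucc : ∀ n, ∫⁻ ρ, g n ρ ∂σ.prob s ≤ ∫⁻ ρ, g (n + 1) ρ ∂σ.prob s := by
    intro n
    let H : Seq S A → S × A → ℝ≥0∞ := fun ρ z =>
      if ρ.Visits B n then 1 else if z.1 ∈ B then 1 else β ^ (n + 1) * f z.1
    have hH : DependsOn H (Set.Iic n) := fun ρ ρ' h => by
      simp only [H, Seq.dependsOn_visits B n h]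
    have : ∀ ρ : Seq S A, g (n + 1) ρ = H ρ (ρ (n + 1)) := by
      intro ρ
      simp only [g, H, Seq.visits_succ]
      by_cases h1 : ρ.Visits B n <;> by_cases h2 : (ρ (n + 1)).1 ∈ B <;> simp [h1, h2]
    simp only [this]
    rw [lintegral_succ σ s n H hH]
    refine lintegral_mono_ae ?_
    filter_upwards [ae_mem_runsFrom σ s] with ρ hρ
    have hρ' := runsFrom_subset_runs σ hs hρ
    by_cases h1 : ρ.Visits B n
    · simp only [g, if_pos h1]
      refine le_trans ?_ (σ.le_stepExp _ _ (g := fun _ => 1) fun t b => by simp [H, h1])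
      rw [sum_pmf_mul_const]
    · simp only [g, if_neg h1]
      refine le_trans ?_ (σ.le_stepExp _ _ (g := fun t => β ^ (n + 1) * f t) fun t b => ?_)
      · have hn : ∀ i ≤ n, ρ.state i ∉ B := fun i hi hB => h1 ⟨i, hi, hB⟩
        have ha : ρ.action n = a (ρ.state n) := by
          refine hσ (ρ.past n) _ (fun z hz => ?_) (hn n le_rfl) (state_mem_of_mem_runs hρ' n) _
            (hρ.2 n).1
          obtain ⟨i, rfl⟩ := (List.mem_ofFn' _ _).1 hz
          exact hn i i.2.le
        change β ^ n * f (ρ.state n) ≤ ∑ t, (M.δ (ρ.state n) (ρ.action n)).toPMF t * _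
        rw [ha, hf _ (state_mem_of_mem_runs hρ' n) (hn n le_rfl), ← mul_assoc, ← pow_succ,
          Finset.mul_sum]
        exact Finset.sum_le_sum fun t _ => (mul_left_comm _ _ _).le
      · simp only [H, if_neg h1]
        split_ifs
        · exact hg1 _ _
        · exact le_rfl
  have hle : ∀ n, f s ≤ σ.prob s (M.reach B) + β ^ n := by
    intro n
    have h1 : f s ≤ ∫⁻ ρ, g n ρ ∂σ.prob s := by
      induction n with
      | zero => exact h0
      | succ n ih => exact ih.trans (hsucc n)
    refine h1.trans ?_
    have hm : MeasurableSet {ρ : Seq S A | ρ.Visits B n} :=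
      measurableSet_setOfPred.2 (measurable_of_dependsOn (Seq.dependsOn_visits B n))
    calc ∫⁻ ρ, g n ρ ∂σ.prob s
        ≤ ∫⁻ ρ, ({ρ : Seq S A | ρ.Visits B n}.indicator 1 ρ + β ^ n) ∂σ.prob s := by
          refine lintegral_mono fun ρ => ?_
          simp only [g]
          split_ifs with h
          · rw [Set.indicator_of_mem (by exact h)]
            exact le_self_add
          · exact le_add_left (mul_le_of_le_one_right' (hf1 _))
      _ = σ.prob s {ρ | ρ.Visits B n} + β ^ n := by
          rw [lintegral_add_right _ measurable_const, lintegral_indicator_one hm]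
          simp
      _ ≤ _ := by
          gcongr ?_ + _
          refine measure_mono_ae ?_
          filter_upwards [ae_mem_runsFrom σ s] with ρ hρ
          rintro ⟨i, -, hi⟩
          exact ⟨runsFrom_subset_runs σ hs hρ, i, hi⟩
  have hlim : Filter.Tendsto (fun n : ℕ => σ.prob s (M.reach B) + β ^ n) Filter.atTop
      (nhds (σ.prob s (M.reach B) + 0)) :=
    tendsto_const_nhds.add (ENNReal.tendsto_pow_atTop_nhds_zero_of_lt_one hβ)
  rw [add_zero] at hlim
  exact ge_of_tendsto' hlim hle

end MDP.Strategy
end Reachability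

/-! ### Switching to a safe strategy at the first visit to `B`. -/

section Switching

lemma Seq.past_add (ρ : Seq S A) (m n : ℕ) :
    ρ.past (m + n) = ρ.past m ++ (ρ.suffix m).past n := by
  induction n with
  | zero => simp [past_zero]
  | succ n ih => rw [← add_assoc, past_succ, ih, past_succ, List.append_assoc]; rfl

lemma Seq.past_succ' (ρ : Seq S A) (n : ℕ) : ρ.past (n + 1) = ρ 0 :: (ρ.suffix 1).past n := by
  rw [add_comm, past_add, past_succ, past_zero]; rfl

namespace MDP

variable {M : MDP S A} {B : Set S}

open Classical in
/-- Follow the policy `a` until `B` is visited, then the strategy `τ` attached to the first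
visited state of `B`. -/
noncomputable def switchNext (a : S → A) (D : B → M.SubMDP) (τ : ∀ t, (D t).toMDP.Strategy) :
    List (S × A) → S → RatDist A
  | [], t => if h : t ∈ B then
      if t ∈ (D ⟨t, h⟩).states then (τ ⟨t, h⟩).next [] t else stdSimplex.vertex (a t)
      else stdSimplex.vertex (a t)
  | z :: l, t => if h : z.1 ∈ B then
      if t ∈ (D ⟨z.1, h⟩).states then (τ ⟨z.1, h⟩).next (z :: l) t else stdSimplex.vertex (a t)
      else switchNext a D τ l t

lemma eq_of_vertex_pos {X : Type*} [Fintype X] [DecidableEq X] {x y : X}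
    (h : 0 < (stdSimplex.vertex x : RatDist X) y) : y = x := by
  rw [stdSimplex.vertex_coe, Pi.single_apply] at h
  by_contra hc
  simp [hc] at h

lemma switchNext_supp {a : S → A} (ha : ∀ t ∈ M.states, a t ∈ M.act t) (D : B → M.SubMDP)
    (τ : ∀ t, (D t).toMDP.Strategy) (h : List (S × A)) :
    ∀ t ∈ M.states, ∀ b, 0 < switchNext a D τ h t b → b ∈ M.act t := by
  classical
  intro t ht b
  induction h with
  | nil =>
    rw [switchNext]
    split_ifs with h1 h2
    · exact fun hb => (D _).act_subset t h2 ((τ _).next_supp _ t h2 b hb)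
    -- Outside the states of `D`, nothing constrains `τ` to available actions; hence the fallback to
    -- `a t`.
    all_goals exact fun hb => eq_of_vertex_pos hb ▸ ha t ht
  | cons z l ih =>
    rw [switchNext]
    split_ifs with h1 h2
    · exact fun hb => (D _).act_subset t h2 ((τ _).next_supp _ t h2 b hb)
    · exact fun hb => eq_of_vertex_pos hb ▸ ha t ht
    · exact ih

/-- The past before the first visit to `B` is stripped, so `τ` sees a history that begins at that
visit. -/
lemma switchNext_append (a : S → A) (D : B → M.SubMDP) (τ : ∀ t, (D t).toMDP.Strategy)
    {h : List (S × A)} (hh : ∀ z ∈ h, z.1 ∉ B) (l : List (S × A)) (t : S) :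
    switchNext a D τ (h ++ l) t = switchNext a D τ l t := by
  induction h with
  | nil => rfl
  | cons z h ih =>
    rw [List.cons_append, switchNext, dif_neg (hh z (by simp)), ih fun y hy => hh y (by simp [hy])]

/-- The strategy that switches from a memoryless policy to strategies in sub-MDPs at the first
visit to `B`. -/
lemma exists_switch {a : S → A} (ha : ∀ t ∈ M.states, a t ∈ M.act t) (D : B → M.SubMDP)
    (hD : ∀ t, t.1 ∈ (D t).states) (τ : ∀ t, (D t).toMDP.Strategy) :
    ∃ σ : M.Strategy, σ.Follows a B ∧ ∀ s, ∀ ρ ∈ σ.runsFrom s, (∃ i, ρ.state i ∈ B) →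
      ∃ i, ∃ h : ρ.state i ∈ B, ρ.suffix i ∈ (τ ⟨ρ.state i, h⟩).runsFrom (ρ.state i) := by
  classical
  refine ⟨⟨switchNext a D τ, switchNext_supp ha D τ⟩, ?_, ?_⟩
  · intro h t hh ht _ b hb
    change 0 < switchNext a D τ h t b at hb
    rw [← List.append_nil h, switchNext_append a D τ hh, switchNext, dif_neg ht] at hb
    exact eq_of_vertex_pos hb
  · intro s ρ hρ hex
    obtain ⟨k, hk, hmin⟩ : ∃ k, ρ.state k ∈ B ∧ ∀ j < k, ρ.state j ∉ B :=
      ⟨Nat.find hex, Nat.find_spec hex, fun j hj => Nat.find_min hex hj⟩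
    have hnext : ∀ i, ρ.state (k + i) ∈ (D ⟨ρ.state k, hk⟩).states →
        switchNext a D τ (ρ.past (k + i)) (ρ.state (k + i)) =
          (τ ⟨ρ.state k, hk⟩).next ((ρ.suffix k).past i) (ρ.state (k + i)) := by
      intro i hi
      rw [Seq.past_add, switchNext_append]
      · cases i with
        | zero => 
          rw [add_zero] at hi ⊢
          rw [Seq.past_zero, switchNext, dif_pos hk, if_pos hi]
        | succ i =>
          have h0 : (ρ.suffix k) 0 = ρ k := rfl
          have hk' : (ρ k).1 ∈ B := hk
          rw [Seq.past_succ', h0, switchNext, dif_pos hk', if_pos (by exact hi)]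
          rfl
      · intro z hz
        obtain ⟨j, rfl⟩ := (List.mem_ofFn' _ _).1 hz
        exact hmin j j.2
    -- While the run is in `D`, the fallback is not used and `τ` is obeyed; closure of `D` under the
    -- actions of `τ` then keeps the run there.
    have hmem : ∀ i, ρ.state (k + i) ∈ (D ⟨ρ.state k, hk⟩).states := by
      intro i
      induction i with
      | zero => exact hD ⟨_, hk⟩
      | succ i ih =>
        have h1 := (hρ.2 (k + i)).1
        change 0 < switchNext a D τ _ _ _ at h1
        rw [hnext i ih] at h1
        exact (D _).closed _ ih _ ((τ _).next_supp _ _ ih _ h1) _ (hρ.2 (k + i)).2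
    refine ⟨k, hk, rfl, fun i => ⟨?_, (hρ.2 (k + i)).2⟩⟩
    have h1 := (hρ.2 (k + i)).1
    change 0 < switchNext a D τ _ _ _ at h1
    rw [hnext i (hmem i)] at h1
    exact h1

lemma SubMDP.toMDP_runs_subset (C : M.SubMDP) : C.toMDP.runs ⊆ M.runs := by
  intro ρ hρ
  have hst := state_mem_of_mem_runs hρ
  exact ⟨C.states_subset (hst 0), fun i => ⟨C.act_subset _ (hst i) (hρ.2 i).1, (hρ.2 i).2⟩⟩

lemma SubMDP.toMDP_DFW_subset (C : M.SubMDP) (Ω : Variant S A) (l : ℕ) :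
    C.toMDP.DFW Ω l ⊆ M.DFW Ω l := by
  rintro ρ ⟨hρ, h⟩
  refine ⟨C.toMDP_runs_subset hρ, fun j => ?_⟩
  cases Ω with
  | mp w => exact ⟨C.toMDP_runs_subset (h j).1, (h j).2⟩
  | par p => exact ⟨C.toMDP_runs_subset (h j).1, (h j).2⟩

end MDP
end Switching

/-! ### Windows as conditions on finite blocks, and the probability of staying in a set of blocks.
-/

section Windows

/-- The good window condition, for arbitrary sequences. -/
def Variant.window : Variant S A → ℕ → Set (Seq S A)
  | .mp w, l => {ρ | ∃ k < l, 0 ≤ ρ.meanPayoff w (k + 1)}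
  | .par p, l => {ρ | ∃ k < l, p (ρ.state k) % 2 = 0 ∧
      ∀ j < k, p (ρ.state k) < p (ρ.state j)}

lemma MDP.mem_GW {M : MDP S A} {Ω : Variant S A} {l : ℕ} {ρ : Seq S A} :
    ρ ∈ M.GW Ω l ↔ ρ ∈ M.runs ∧ ρ ∈ Ω.window l := by
  cases Ω <;> rfl

/-- A window of bound `l` only inspects `l` pairs. This reduces the objective to a finite state
space of blocks. -/
lemma Variant.window_congr {Ω : Variant S A} {l : ℕ} {ρ ρ' : Seq S A} (h : ∀ i < l, ρ i = ρ' i)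
    (hρ : ρ ∈ Ω.window l) : ρ' ∈ Ω.window l := by
  cases Ω with
  | mp w =>
    obtain ⟨k, hk, h0⟩ := hρ
    refine ⟨k, hk, ?_⟩
    have : ρ'.meanPayoff w (k + 1) = ρ.meanPayoff w (k + 1) := by
      unfold Seq.meanPayoff
      congr 1
      refine Finset.sum_congr rfl fun i hi => ?_
      rw [Seq.action, Seq.action, h i (by have := Finset.mem_range.1 hi; omega)]
    rwa [this]
  | par p =>
    obtain ⟨k, hk, h0, h1⟩ := hρ
    have hst : ∀ i < l, ρ.state i = ρ'.state i := fun i hi => congrArg Prod.fst (h i hi)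
    refine ⟨k, hk, by rwa [← hst k hk], fun j hj => ?_⟩
    rw [← hst k hk, ← hst j (hj.trans hk)]
    exact h1 j hj

/-- `m + 1` consecutive state-action pairs. -/
abbrev Block (S A : Type*) (m : ℕ) : Type _ := Fin (m + 1) → S × A

namespace Block

variable {m : ℕ}

/-- The last state-action pair. -/
def last (x : Block S A m) : S × A := x (Fin.last m)

/-- Drop the first pair and append `z`. -/
def shift (x : Block S A m) (z : S × A) : Block S A m := fun i =>
  if h : i.1 + 1 < m + 1 then x ⟨i.1 + 1, h⟩ else z

lemma last_shift (x : Block S A m) (z : S × A) : (x.shift z).last = z := by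
  simp [last, shift]

/-- The sequence that follows `x` and then stays constant. -/
def extend (x : Block S A m) : Seq S A := fun n => x ⟨min n m, by omega⟩

/-- The block of `ρ` that starts at `j`. -/
def ofSeq (m : ℕ) (ρ : Seq S A) (j : ℕ) : Block S A m := fun i => ρ (j + i)

lemma extend_ofSeq (ρ : Seq S A) (j : ℕ) : ∀ i < m + 1, ρ.suffix j i = (ofSeq m ρ j).extend i := by
  intro i hi
  simp only [Seq.suffix, extend, ofSeq]
  rw [min_eq_left (by omega)]

lemma last_ofSeq (ρ : Seq S A) (j : ℕ) : (ofSeq m ρ j).last = ρ (j + m) := rfl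

lemma shift_ofSeq (ρ : Seq S A) (j : ℕ) :
    (ofSeq m ρ j).shift (ρ (j + m + 1)) = ofSeq m ρ (j + 1) := by
  funext i
  simp only [shift, ofSeq]
  split_ifs with h
  · congr 1; omega
  · congr 1; omega

lemma ofSeq_congr {ρ ρ' : Seq S A} {j n : ℕ} (hj : j + m ≤ n) (h : ∀ i ∈ Set.Iic n, ρ i = ρ' i) :
    ofSeq m ρ j = ofSeq m ρ' j := by
  funext i
  exact h _ (Set.mem_Iic.2 (by omega))

end Block

section StayValue

variable {m : ℕ} (M : MDP S A)

open Classical in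
/-- The optimal probability that the next `n` blocks after `x`, and `x` itself, belong to `Q`. -/
noncomputable def stayValue (Q : Set (Block S A m)) : ℕ → Block S A m → ℝ≥0∞
  | 0, x => if x ∈ Q then 1 else 0
  | n + 1, x => if x ∈ Q then ∑ t, (M.δ x.last.1 x.last.2).toPMF t *
      Finset.univ.sup fun b => stayValue Q n (x.shift (t, b)) else 0

lemma stayValue_of_notMem {Q : Set (Block S A m)} {x : Block S A m} (hx : x ∉ Q) (n : ℕ) :
    stayValue M Q n x = 0 := by
  cases n <;> simp [stayValue, hx]

lemma stayValue_succ {Q : Set (Block S A m)} {x : Block S A m} (hx : x ∈ Q) (n : ℕ) :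
    stayValue M Q (n + 1) x = ∑ t, (M.δ x.last.1 x.last.2).toPMF t *
      Finset.univ.sup fun b => stayValue M Q n (x.shift (t, b)) := by
  simp [stayValue, hx]

lemma stayValue_le_one (Q : Set (Block S A m)) (n : ℕ) (x : Block S A m) :
    stayValue M Q n x ≤ 1 := by
  induction n generalizing x with
  | zero => unfold stayValue; split_ifs <;> simp
  | succ n ih =>
    by_cases hx : x ∈ Q
    · rw [stayValue_succ M hx]
      exact sum_pmf_mul_le _ fun t _ => Finset.sup_le fun b _ => ih _
    · simp [stayValue_of_notMem M hx]

lemma stayValue_antitone (Q : Set (Block S A m)) (x : Block S A m) :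
    Antitone fun n => stayValue M Q n x := by
  refine antitone_nat_of_succ_le fun n => ?_
  induction n generalizing x with
  | zero =>
    by_cases hx : x ∈ Q
    · refine (stayValue_le_one M Q 1 x).trans ?_
      simp [stayValue, hx]
    · simp [stayValue_of_notMem M hx]
  | succ n ih =>
    by_cases hx : x ∈ Q
    · rw [stayValue_succ M hx, stayValue_succ M hx]
      exact Finset.sum_le_sum fun t _ => mul_le_mul_right (Finset.sup_mono_fun fun b _ => ih _) _
    · simp [stayValue_of_notMem M hx]

/-- If one can stay in `Q` for ever with positive probability, then one can do so surely from
some block. -/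
lemma exists_closed_of_stayValue {Q : Set (Block S A m)}
    (h : ∃ x, ¬ Filter.Tendsto (fun n => stayValue M Q n x) Filter.atTop (nhds 0)) :
    ∃ R ⊆ Q, R.Nonempty ∧ ∀ x ∈ R, ∀ t, 0 < M.δ x.last.1 x.last.2 t → ∃ b, x.shift (t, b) ∈ R := by
  -- The limit value of staying in `Q` forever; it inherits the optimality equation because the sums
  -- and suprema are finite.
  let u : Block S A m → ℝ≥0∞ := fun x => ⨅ n, stayValue M Q n x
  have hu : ∀ x, Filter.Tendsto (fun n => stayValue M Q n x) Filter.atTop (nhds (u x)) := fun x =>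
    tendsto_atTop_iInf (stayValue_antitone M Q x)
  have hu1 : ∀ x, u x ≤ 1 := fun x => (iInf_le _ 0).trans (stayValue_le_one M Q 0 x)
  have hstep : ∀ x ∈ Q, u x = ∑ t, (M.δ x.last.1 x.last.2).toPMF t *
      Finset.univ.sup fun b => u (x.shift (t, b)) := by
    intro x hx
    refine tendsto_nhds_unique ((hu x).comp (Filter.tendsto_add_atTop_nat 1)) ?_
    simp only [Function.comp_def, stayValue_succ M hx]
    refine tendsto_finsetSum _ fun t _ => ENNReal.Tendsto.const_mul ?_
      (Or.inr (PMF.apply_ne_top _ _))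
    exact Filter.Tendsto.finset_sup_nhds_apply fun b _ => hu _
  obtain ⟨x₁, hx₁⟩ := h
  have hx₁0 : u x₁ ≠ 0 := fun h0 => hx₁ (h0 ▸ hu x₁)
  obtain ⟨x₀, -, hmax⟩ := Finset.exists_max_image Finset.univ u ⟨x₁, Finset.mem_univ _⟩
  have hx₀0 : u x₀ ≠ 0 := fun h0 => hx₁0 (le_antisymm (h0 ▸ hmax x₁ (Finset.mem_univ _)) zero_le)
  have hRQ : {x | u x = u x₀} ⊆ Q := by
    intro x hx
    by_contra hxQ
    refine hx₀0 (hx ▸ ?_)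
    simp [u, stayValue_of_notMem M hxQ]
  refine ⟨{x | u x = u x₀}, hRQ, ⟨x₀, rfl⟩, fun x hx t ht => ?_⟩
  have hA : (Finset.univ : Finset A).Nonempty := ⟨x.last.2, Finset.mem_univ _⟩
  obtain ⟨b, -, hb⟩ := Finset.exists_mem_eq_sup Finset.univ hA fun b => u (x.shift (t, b))
  refine ⟨b, ?_⟩
  have hx' : u x = u x₀ := hx
  rw [Set.mem_ofPred_eq, ← hb]
  -- At a maximiser of `u`, an average of values bounded by the maximum equals it, so each possible
  -- successor state admits an action leading to a maximiser.
  refine eq_of_sum_pmf_le (M.δ x.last.1 x.last.2).toPMF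
    (f := fun t => Finset.univ.sup fun b => u (x.shift (t, b))) (g := fun _ => u x₀)
    (fun t _ => Finset.sup_le fun b _ => hmax _ (Finset.mem_univ _))
    (fun t _ => ne_top_of_le_ne_top ENNReal.one_ne_top (Finset.sup_le fun b _ => hu1 _)) ?_
    ((RatDist.toPMF_ne_zero _ _).2 ht)
  rw [← hstep x (hRQ hx), hx']
  exact sum_pmf_mul_le _ fun _ _ => le_rfl

variable {M}
variable [MeasurableSpace S] [DiscreteMeasurableSpace S]
  [MeasurableSpace A] [DiscreteMeasurableSpace A]

/-- The sum over all blocks crudely covers the unknown block at time `i`; it suffices because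
finitely many terms each tend to `0`. -/
lemma MDP.Strategy.prob_stay_le (σ : M.Strategy) (s : S) (Q : Set (Block S A m)) (i n : ℕ) :
    σ.prob s {ρ | ∀ j, Block.ofSeq m ρ (i + j) ∈ Q} ≤ ∑ x, stayValue M Q n x := by
  classical
  -- `k` steps already observed, `n` still to be played optimally: exchanging an observed step for
  -- an optimal one never lowers the expectation.
  let F : ℕ → ℕ → Seq S A → ℝ≥0∞ := fun k n ρ =>
    if ∀ j < k, Block.ofSeq m ρ (i + j) ∈ Q then stayValue M Q n (Block.ofSeq m ρ (i + k)) else 0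
  have hpre : ∀ k N, i + k + m ≤ N + 1 → ∀ ρ ρ' : Seq S A, (∀ j ∈ Set.Iic N, ρ j = ρ' j) →
      ((∀ j < k, Block.ofSeq m ρ (i + j) ∈ Q) ↔ ∀ j < k, Block.ofSeq m ρ' (i + j) ∈ Q) := by
    intro k N hN ρ ρ' h
    refine forall₂_congr fun j hj => ?_
    rw [Block.ofSeq_congr (by omega) h]
  have hF : ∀ k n, DependsOn (F k n) (Set.Iic (i + k + m)) := fun k n ρ ρ' h => by
    simp only [F, hpre k _ (by omega) ρ ρ' h, Block.ofSeq_congr le_rfl h]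
  have hsucc : ∀ k n, ∫⁻ ρ, F (k + 1) n ρ ∂σ.prob s ≤ ∫⁻ ρ, F k (n + 1) ρ ∂σ.prob s := by
    intro k n
    let H : Seq S A → S × A → ℝ≥0∞ := fun ρ z =>
      if ∀ j < k + 1, Block.ofSeq m ρ (i + j) ∈ Q then
        stayValue M Q n ((Block.ofSeq m ρ (i + k)).shift z) else 0
    have hH : DependsOn H (Set.Iic (i + k + m)) := fun ρ ρ' h => by
      funext z
      simp only [H, hpre (k + 1) _ (by omega) ρ ρ' h, Block.ofSeq_congr le_rfl h]
    have : ∀ ρ : Seq S A, F (k + 1) n ρ = H ρ (ρ (i + k + m + 1)) := by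
      intro ρ
      simp only [F, H, Block.shift_ofSeq]
      rfl
    simp only [this]
    rw [σ.lintegral_succ s (i + k + m) H hH]
    refine lintegral_mono fun ρ => ?_
    by_cases h : ∀ j < k + 1, Block.ofSeq m ρ (i + j) ∈ Q
    · have hk : ∀ j < k, Block.ofSeq m ρ (i + j) ∈ Q := fun j hj => h j (by omega)
      simp only [F, if_pos hk]
      rw [stayValue_succ M (h k (by omega)), Block.last_ofSeq]
      refine σ.stepExp_le _ _ fun t b => ?_
      simp only [H, if_pos h]
      exact Finset.le_sup
        (f := fun b => stayValue M Q n ((Block.ofSeq m ρ (i + k)).shift (t, b))) (Finset.mem_univ b)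
    · refine (σ.stepExp_le _ _ (g := fun _ => 0) fun t b => ?_).trans (by simp)
      simp only [H, if_neg h, le_refl]
  have hall : ∀ k n, ∫⁻ ρ, F k n ρ ∂σ.prob s ≤ ∫⁻ ρ, F 0 (n + k) ρ ∂σ.prob s := by
    intro k
    induction k with
    | zero => exact fun n => le_rfl
    | succ k ih =>
      intro n
      refine (hsucc k n).trans ((ih (n + 1)).trans_eq ?_)
      rw [add_right_comm, add_assoc]
  have hmeas := mul_meas_ge_le_lintegral (μ := σ.prob s) (measurable_of_dependsOn (hF n 0)) 1
  rw [one_mul] at hmeas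
  calc σ.prob s {ρ | ∀ j, Block.ofSeq m ρ (i + j) ∈ Q}
      ≤ σ.prob s {ρ | 1 ≤ F n 0 ρ} := by
        refine measure_mono fun ρ hρ => ?_
        have h1 : ∀ j < n, Block.ofSeq m ρ (i + j) ∈ Q := fun j _ => hρ j
        have h2 : Block.ofSeq m ρ (i + n) ∈ Q := hρ n
        simp only [Set.mem_ofPred_eq, F, if_pos h1, stayValue, if_pos h2, le_refl]
    _ ≤ ∫⁻ ρ, F n 0 ρ ∂σ.prob s := hmeas
    _ ≤ ∫⁻ ρ, F 0 n ρ ∂σ.prob s := by simpa using hall n 0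
    _ ≤ ∫⁻ _, ∑ x, stayValue M Q n x ∂σ.prob s := by
        refine lintegral_mono fun ρ => ?_
        simp only [F, Nat.not_lt_zero, false_implies, implies_true, if_true]
        exact Finset.single_le_sum (fun _ _ => zero_le) (Finset.mem_univ _)
    _ = ∑ x, stayValue M Q n x := by simp

end StayValue

end Windows

/-! ### Extracting a safe end-component from a set of good blocks. -/

section SafeComponents

/-- A finite closed set can be refined to a set that is strongly connected. -/
lemma exists_bottom {X : Type*} [Finite X] (E : X → X → Prop) {R : Set X} (hne : R.Nonempty)
    (hR : ∀ x ∈ R, ∀ y, E x y → y ∈ R) :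
    ∃ K ⊆ R, K.Nonempty ∧ (∀ x ∈ K, ∀ y, E x y → y ∈ K) ∧
      ∀ x ∈ K, ∀ y ∈ K, Relation.ReflTransGen E x y := by
  -- With the reachable set of `x₀` of minimal size, every point reachable from `x₀` has the same
  -- reachable set.
  obtain ⟨x₀, hx₀, hmin⟩ := Set.exists_min_image R
    (fun x => {y | Relation.ReflTransGen E x y}.ncard) (Set.toFinite _) hne
  have hsub : ∀ y, Relation.ReflTransGen E x₀ y → y ∈ R := by
    intro y hy
    induction hy with
    | refl => exact hx₀
    | tail _ h ih => exact hR _ ih _ h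
  refine ⟨{y | Relation.ReflTransGen E x₀ y}, hsub, ⟨x₀, .refl⟩, fun x hx y hxy => hx.tail hxy, ?_⟩
  intro x hx y hy
  have heq : {z | Relation.ReflTransGen E x z} = {z | Relation.ReflTransGen E x₀ z} :=
    Set.eq_of_subset_of_ncard_le (fun z hz => Relation.ReflTransGen.trans hx hz)
      (hmin x (hsub x hx)) (Set.toFinite _)
  have : y ∈ {z | Relation.ReflTransGen E x z} := by rw [heq]; exact hy
  exact this

variable {m : ℕ} {M : MDP S A}

open Classical in
/-- The memory of the strategy that extends blocks of `K` by the choice function `f`, after the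
reversed history `h` and the state `t`; it starts with the block `pick t`. -/
noncomputable def blockMemory (M : MDP S A) (K : Set (Block S A m)) (f : Block S A m → S → A)
    (pick : S → Block S A m) : List (S × A) → S → Block S A m
  | [], t => pick t
  | z :: h, t =>
    let x := blockMemory M K f pick h z.1
    if x ∈ K ∧ 0 < M.δ x.last.1 x.last.2 t then x.shift (t, f x t) else pick t

/-- From a set of good blocks in which one can stay surely, one obtains a safe end-component. -/
lemma exists_safe_of_closed (Ω : Variant S A) {R : Set (Block S A m)} (hne : R.Nonempty)
    (hR : ∀ x ∈ R, ∀ t, 0 < M.δ x.last.1 x.last.2 t → ∃ b, x.shift (t, b) ∈ R)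
    (hgood : ∀ x ∈ R, x.extend ∈ Ω.window (m + 1))
    (hst : ∀ x ∈ R, x.last.1 ∈ M.states) (hact : ∀ x ∈ R, x.last.2 ∈ M.act x.last.1) :
    ∃ D : M.SubMDP, D.IsEC ∧ D.IsSafe Ω (m + 1) ∧ ∀ t ∈ D.states, ∃ x ∈ R, x.last.1 = t := by
  classical
  have hf : ∀ x t, ∃ b, x ∈ R → 0 < M.δ x.last.1 x.last.2 t → x.shift (t, b) ∈ R := by
    intro x t
    by_cases h : x ∈ R ∧ 0 < M.δ x.last.1 x.last.2 t
    · obtain ⟨b, hb⟩ := hR x h.1 t h.2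
      exact ⟨b, fun _ _ => hb⟩
    · exact ⟨x.last.2, fun h1 h2 => absurd ⟨h1, h2⟩ h⟩
  choose f hf using hf
  obtain ⟨K, hKR, hKne, hKcl, hKconn⟩ := exists_bottom
    (fun x y => ∃ t, 0 < M.δ x.last.1 x.last.2 t ∧ y = x.shift (t, f x t)) hne
    (by rintro x hx _ ⟨t, ht, rfl⟩; exact hf x t hx ht)
  -- The projection of `K` to last pairs; block edges project to edges of `D`, so connectivity is
  -- inherited.
  let D : M.SubMDP :=
    { states := {t | ∃ x ∈ K, x.last.1 = t}
      act := fun t => {a | ∃ x ∈ K, x.last = (t, a)}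
      states_subset := by rintro _ ⟨x, hx, rfl⟩; exact hst x (hKR hx)
      act_subset := by
        rintro t - a ⟨x, hx, hxa⟩
        have := hact x (hKR hx)
        rwa [hxa] at this
      act_nonempty_iff := by
        intro t
        constructor
        · rintro ⟨a, x, hx, hxa⟩
          exact ⟨x, hx, by rw [hxa]⟩
        · rintro ⟨x, hx, rfl⟩
          exact ⟨x.last.2, x, hx, rfl⟩
      closed := by
        rintro t - a ⟨x, hx, hxa⟩ u hu
        refine ⟨x.shift (u, f x u), hKcl x hx _ ⟨u, ?_, rfl⟩, by rw [Block.last_shift]⟩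
        rwa [hxa] }
  have hpick : ∀ t, ∃ x : Block S A m, t ∈ D.states → x ∈ K ∧ x.last.1 = t := by
    intro t
    by_cases h : t ∈ D.states
    · obtain ⟨x, hx⟩ := h
      exact ⟨x, fun _ => hx⟩
    · exact ⟨hKne.some, fun h' => absurd h' h⟩
  choose pick hpick using hpick
  let mem := blockMemory M K f pick
  -- Resetting to `pick t` makes this hold for arbitrary lists `h`, as the support condition of a
  -- strategy demands.
  have hmem : ∀ h t, t ∈ D.states → mem h t ∈ K ∧ (mem h t).last.1 = t := by
    intro h t ht
    cases h with
    | nil => exact hpick t ht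
    | cons z h =>
      simp only [mem, blockMemory]
      split_ifs with hc
      · exact ⟨hKcl _ hc.1 _ ⟨t, hc.2, rfl⟩, by rw [Block.last_shift]⟩
      · exact hpick t ht
  refine ⟨D, ⟨?_, ?_⟩, ?_, fun t ⟨x, hx, hxt⟩ => ⟨x, hKR hx, hxt⟩⟩
  · exact ⟨_, hKne.some, hKne.some_mem, rfl⟩
  · rintro _ ⟨x, hx, rfl⟩ _ ⟨y, hy, rfl⟩
    have hxy := hKconn x hx y hy
    clear hy
    have : y ∈ K ∧ Relation.ReflTransGen D.Edge x.last.1 y.last.1 := by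
      induction hxy with
      | refl => exact ⟨hx, .refl⟩
      | @tail y z _ hyz ih =>
        refine ⟨hKcl y ih.1 z hyz, ih.2.tail ?_⟩
        obtain ⟨t, ht, rfl⟩ := hyz
        rw [Block.last_shift]
        exact ⟨y.last.2, ⟨y, ih.1, rfl⟩, ht⟩
    exact this.2
  · let τ : D.toMDP.Strategy :=
      -- Reversed because `blockMemory` recurses from the most recent pair.
      { next := fun h t => stdSimplex.vertex (mem h.reverse t).last.2
        next_supp := by
          intro h t ht b hb
          have h1 := hmem h.reverse t ht
          rw [MDP.eq_of_vertex_pos hb]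
          exact ⟨_, h1.1, Prod.ext h1.2 rfl⟩ }
    refine ⟨τ, fun s hs ρ hρ => ?_⟩
    have hruns : ρ ∈ D.toMDP.runs := MDP.Strategy.runsFrom_subset_runs τ hs hρ
    have hDst : ∀ n, ρ.state n ∈ D.states := MDP.state_mem_of_mem_runs hruns
    let x : ℕ → Block S A m := fun n => mem (ρ.past n).reverse (ρ.state n)
    have hxK : ∀ n, x n ∈ K := fun n => (hmem _ _ (hDst n)).1
    have hlast : ∀ n, (x n).last = ρ n := fun n =>
      Prod.ext (hmem _ _ (hDst n)).2 (MDP.eq_of_vertex_pos (hρ.2 n).1).symm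
    have hnext : ∀ n, x (n + 1) = (x n).shift (ρ (n + 1)) := by
      intro n
      have h1 : x (n + 1) = (x n).shift (ρ.state (n + 1), f (x n) (ρ.state (n + 1))) := by
        have h2 : 0 < M.δ (x n).last.1 (x n).last.2 (ρ.state (n + 1)) := by
          rw [hlast]; exact (hρ.2 n).2
        have h3 : x (n + 1) = blockMemory M K f pick (ρ n :: (ρ.past n).reverse)
            (ρ.state (n + 1)) := by
          simp only [x, mem, Seq.past_succ, List.reverse_append, List.reverse_singleton,
            List.singleton_append]
        rw [h3, blockMemory]
        exact if_pos ⟨hxK n, h2⟩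
      have h4 := hlast (n + 1)
      rw [h1, Block.last_shift] at h4
      rw [h1, h4]
    -- The initial block has an invented past, which is shifted out after `m` steps. The window at
    -- `j` is thus read off the memory at time `j + m`, already for `j = 0`.
    have hx : ∀ n k (hk : k ≤ m), k ≤ n → x n ⟨m - k, by omega⟩ = ρ (n - k) := by
      intro n
      induction n with
      | zero =>
        intro k hk hk0
        obtain rfl := Nat.le_zero.1 hk0
        exact hlast 0
      | succ n ih =>
        intro k hk hkn
        cases k with
        | zero => exact hlast (n + 1)
        | succ k =>
          rw [hnext, Block.shift, dif_pos (by simp only; omega), Nat.add_sub_add_right,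
            ← ih k (by omega) (by omega)]
          congr 2
          simp only
          omega
    refine ⟨hruns, fun j => MDP.mem_GW.2 ⟨MDP.suffix_mem_runs hruns j, ?_⟩⟩
    refine Variant.window_congr (fun i hi => ?_) (hgood _ (hKR (hxK (j + m))))
    have h1 := hx (j + m) (m - i) (by omega) (by omega)
    rw [show j + m - (m - i) = j + i by omega] at h1
    simp only [Seq.suffix, ← h1, Block.extend]
    congr 2
    omega

variable [MeasurableSpace S] [DiscreteMeasurableSpace S]
  [MeasurableSpace A] [DiscreteMeasurableSpace A]

/-- If `T` contains all safe end-components, then `FW` almost surely implies reaching `T`. -/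
lemma prob_FW_diff_reach (σ : M.Strategy) (s : S) (Ω : Variant S A) {l : ℕ} (hl : 0 < l)
    {T : Set S} (hT : ∀ D : M.SubMDP, D.IsEC → D.IsSafe Ω l → D.states ⊆ T) :
    σ.prob s (M.FW Ω l \ M.reach T) = 0 := by
  obtain ⟨m, rfl⟩ : ∃ m, l = m + 1 := ⟨l - 1, by omega⟩
  -- Availability of the last action is imposed here because `stayValue` maximises over all of `A`.
  let Q : Set (Block S A m) := {x | x.extend ∈ Ω.window (m + 1) ∧ x.last.1 ∈ M.states ∧
    x.last.2 ∈ M.act x.last.1 ∧ x.last.1 ∉ T}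
  have hlim : ∀ x, Filter.Tendsto (fun n => stayValue M Q n x) Filter.atTop (nhds 0) := by
    by_contra hc
    push Not at hc
    obtain ⟨R, hRQ, hne, hR⟩ := exists_closed_of_stayValue M hc
    obtain ⟨D, hEC, hsafe, hD⟩ := exists_safe_of_closed Ω hne hR (fun x hx => (hRQ hx).1)
      (fun x hx => (hRQ hx).2.1) fun x hx => (hRQ hx).2.2.1
    obtain ⟨t, ht⟩ := hEC.1
    obtain ⟨x, hx, rfl⟩ := hD t ht
    exact (hRQ hx).2.2.2 (hT D hEC hsafe ht)
  have hsub : M.FW Ω (m + 1) \ M.reach T ⊆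
      ⋃ i, {ρ | ∀ j, Block.ofSeq m ρ (i + j) ∈ Q} := by
    rintro ρ ⟨⟨hρ, i, -, hi⟩, hreach⟩
    refine Set.mem_iUnion.2 ⟨i, fun j => ⟨?_, ?_, ?_, ?_⟩⟩
    · refine Variant.window_congr (fun k hk => ?_) (MDP.mem_GW.1 (hi j)).2
      rw [← Block.extend_ofSeq ρ (i + j) k hk]
      simp only [Seq.suffix, add_assoc]
    · exact MDP.state_mem_of_mem_runs hρ _
    · exact (hρ.2 _).1
    · exact fun h => hreach ⟨hρ, _, h⟩
  refine measure_mono_null hsub (measure_iUnion_null fun i => ?_)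
  have hsum : Filter.Tendsto (fun n => ∑ x, stayValue M Q n x) Filter.atTop (nhds 0) := by
    simpa using tendsto_finsetSum Finset.univ fun x _ => hlim x
  exact le_antisymm (ge_of_tendsto' hsum fun n => σ.prob_stay_le s Q i n) zero_le

end SafeComponents

/-! ### Maximal end-components and the common sandwich argument. -/

section Main

namespace MDP

variable {M : MDP S A}

lemma SubMDP.IsEC.exists_le_isMEC {C : M.SubMDP} (hC : C.IsEC) :
    ∃ D : M.SubMDP, C ≤ D ∧ D.IsMEC := by
  -- Existence of maximal elements in a finite set needs a preorder; it is built on the given `≤`.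
  let inst : Preorder M.SubMDP :=
    { toLE := inferInstance
      le_refl := fun C => ⟨subset_rfl, fun _ => subset_rfl⟩
      le_trans := fun C D E h h' => ⟨h.1.trans h'.1, fun s => (h.2 s).trans (h'.2 s)⟩ }
  exact (Set.toFinite {C : M.SubMDP | C.IsEC}).exists_le_maximal hC

lemma collect_eq (good : M.SubMDP → Prop) :
    M.collect good = ⋃ C ∈ {C : M.SubMDP | C.IsMEC ∧ good C}, C.states := by
  classical
  have key : ∀ (L : List M.SubMDP) (T : Set S) (t : S),
      t ∈ L.foldl (fun T C => if good C then T ∪ C.states else T) T ↔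
        t ∈ T ∨ ∃ C ∈ L, good C ∧ t ∈ C.states := by
    intro L
    induction L with
    | nil => simp
    | cons C L ih =>
      intro T t
      rw [List.foldl_cons, ih]
      by_cases h : good C
      · simp [h, or_assoc]
      · simp [h]
  ext t
  have h := key M.mecs.toList ∅ t
  unfold collect
  convert h using 1
  simp [mecs, and_assoc]

variable [MeasurableSpace S] [DiscreteMeasurableSpace S]
  [MeasurableSpace A] [DiscreteMeasurableSpace A]

/-- The common argument for both objectives: `P` selects some safe end-components, runs that follow
their strategies win, and winning runs almost surely reach a maximal end-component that contains
one of them. -/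
lemma isGreatest_of_safe {s : S} (hs : s ∈ M.states) (P : M.SubMDP → Prop)
    {W : Set (Seq S A)}
    (hP : ∀ D : M.SubMDP, D.IsEC → P D → ∃ τ : D.toMDP.Strategy, ∀ t ∈ D.states,
      ∀ ρ ∈ M.runs, ∀ i, ρ.suffix i ∈ τ.runsFrom t → ρ ∈ W)
    (hW : ∀ (σ : M.Strategy) (T : Set S), (∀ D : M.SubMDP, D.IsEC → P D → D.states ⊆ T) →
      σ.prob s (W \ M.reach T) = 0)
    {T : Set S}
    (hT : T = ⋃ C ∈ {C : M.SubMDP | C.IsMEC ∧ ∃ D ≤ C, D.IsEC ∧ P D}, C.states) :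
    IsGreatest (Set.range fun σ : M.Strategy => σ.prob s W) (M.maxReachability s T) ∧
      IsGreatest (Set.range fun σ : M.Strategy => σ.prob s (M.reach T))
        (M.maxReachability s T) := by
  -- The strategy aims at `B`, not `T`, since only there does a winning strategy start at once.
  let B : Set S := {t | ∃ D : M.SubMDP, D.IsEC ∧ P D ∧ t ∈ D.states}
  have hBT : ∀ D : M.SubMDP, D.IsEC → P D → D.states ⊆ T := by
    intro D hD hPD t ht
    obtain ⟨C, hDC, hC⟩ := hD.exists_le_isMEC
    rw [hT]
    exact Set.mem_biUnion (show C ∈ {C : M.SubMDP | _} from ⟨hC, D, hDC, hD, hPD⟩) (hDC.1 ht)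
  obtain ⟨V, a, ha, hV1, hVB, hsup, hV⟩ := M.exists_value hs B
  have hVT : ∀ t ∈ T, V t = 1 := by
    intro t ht
    rw [hT] at ht
    obtain ⟨C, ⟨hC, D, hDC, hD, hPD⟩, ht⟩ := Set.mem_iUnion₂.1 ht
    obtain ⟨t₁, ht₁⟩ := hD.1
    exact hC.prop.eq_one hV1 hsup (hDC.1 ht₁) (hVB t₁ ⟨D, hD, hPD, ht₁⟩) ht
  have hreach : ∀ σ : M.Strategy, σ.prob s (M.reach T) ≤ V s := fun σ =>
    σ.prob_reach_le hs hVT hsup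
  have hWle : ∀ σ : M.Strategy, σ.prob s W ≤ σ.prob s (M.reach T) := by
    intro σ
    refine (measure_mono (Set.subset_sdiff_union W (M.reach T))).trans
      ((measure_union_le _ _).trans ?_)
    rw [hW σ T hBT, zero_add]
  choose D hD hPD hDt using fun t : B => t.2
  choose τ hτ using fun t : B => hP (D t) (hD t) (hPD t)
  obtain ⟨σ, hσ, hσruns⟩ := exists_switch ha D hDt τ
  have hVσ : V s ≤ σ.prob s W := by
    refine (hV s _ fun β hβ f hf1 hf => σ.le_prob_reach hs hσ hβ hf1 hf).trans ?_
    refine measure_mono_ae ?_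
    filter_upwards [σ.ae_mem_runsFrom s] with ρ hρ
    rintro ⟨hρ', hex⟩
    obtain ⟨i, hi, hmem⟩ := hσruns s ρ hρ hex
    exact hτ _ _ (hDt ⟨_, hi⟩) ρ hρ' i hmem
  have hVmax : M.maxReachability s T = V s :=
    le_antisymm (iSup_le hreach) ((hVσ.trans (hWle σ)).trans
      (le_iSup (fun σ : M.Strategy => σ.prob s (M.reach T)) σ))
  rw [hVmax]
  refine ⟨⟨⟨σ, le_antisymm ((hWle σ).trans (hreach σ)) hVσ⟩, ?_⟩,
    ⟨σ, le_antisymm (hreach σ) (hVσ.trans (hWle σ))⟩, ?_⟩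
  · rintro _ ⟨σ, rfl⟩
    exact (hWle σ).trans (hreach σ)
  · rintro _ ⟨σ, rfl⟩
    exact hreach σ

lemma mem_FW_of_suffix {D : M.SubMDP} {Ω : Variant S A} {l i : ℕ} {τ : D.toMDP.Strategy} {t : S}
    (hτ : τ.runsFrom t ⊆ D.toMDP.DFW Ω l) {ρ : Seq S A} (hρ : ρ ∈ M.runs)
    (hi : ρ.suffix i ∈ τ.runsFrom t) : ρ ∈ M.FW Ω l :=
  ⟨hρ, i, D.toMDP_DFW_subset Ω l (hτ hi)⟩

end MDP

end Main

end WindowMDP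

theorem lemma6p1 {S A : Type*} [Fintype S] [Fintype A]
    [MeasurableSpace S] [DiscreteMeasurableSpace S]
    [MeasurableSpace A] [DiscreteMeasurableSpace A]
    (M : WindowMDP.MDP S A) (s : S) (hs : s ∈ M.states) (Ω : WindowMDP.Variant S A)
    (l : ℕ) (hl : 0 < l) :
    (IsGreatest (Set.range fun σ : M.Strategy => σ.prob s (M.FW Ω l)) (M.fixedWindow s Ω l) ∧
      IsGreatest (Set.range fun σ : M.Strategy =>
        σ.prob s (M.reach (⋃ C ∈ {C : M.SubMDP | C.IsMEC ∧ C.IsGood Ω l}, C.states)))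
        (M.fixedWindow s Ω l)) ∧
    (IsGreatest (Set.range fun σ : M.Strategy => σ.prob s (M.BW Ω)) (M.boundedWindow s Ω) ∧
      IsGreatest (Set.range fun σ : M.Strategy =>
        σ.prob s (M.reach (⋃ C ∈ {C : M.SubMDP | C.IsMEC ∧ C.IsBWGood Ω}, C.states)))
        (M.boundedWindow s Ω)) := by
  rw [WindowMDP.MDP.fixedWindow, WindowMDP.MDP.boundedWindow, WindowMDP.MDP.collect_eq,
    WindowMDP.MDP.collect_eq]
  constructor
  · refine WindowMDP.MDP.isGreatest_of_safe hs (fun D => D.IsSafe Ω l) ?_ ?_ rfl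
    · rintro D - ⟨τ, hτ⟩
      exact ⟨τ, fun t ht ρ hρ i hi => WindowMDP.MDP.mem_FW_of_suffix (hτ t ht) hρ hi⟩
    · exact fun σ T hT => WindowMDP.prob_FW_diff_reach σ s Ω hl hT
  · refine WindowMDP.MDP.isGreatest_of_safe hs (fun D => ∃ l > 0, D.IsSafe Ω l) ?_ ?_ rfl
    · rintro D - ⟨l, hl, τ, hτ⟩
      exact ⟨τ, fun t ht ρ hρ i hi =>
        ⟨hρ, l, hl, WindowMDP.MDP.mem_FW_of_suffix (hτ t ht) hρ hi⟩⟩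
    · intro σ T hT
      -- Here `T` contains the safe end-components for every bound, so each piece of the countable
      -- union is null.
      have hsub : M.BW Ω \ M.reach T ⊆ ⋃ l : ℕ, ⋃ _ : 0 < l, M.FW Ω l \ M.reach T := by
        rintro ρ ⟨⟨-, l, hl, hρ⟩, hr⟩
        exact Set.mem_iUnion₂.2 ⟨l, hl, hρ, hr⟩
      refine measure_mono_null hsub (measure_iUnion_null fun l => measure_iUnion_null fun hl => ?_)
      exact WindowMDP.prob_FW_diff_reach σ s Ω hl fun D hD hsafe => hT D hD ⟨l, hl, hsafe⟩
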